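/- Let $d\ge 2$, let $S_d\subset\mathbb R^d$ be a nondegenerate $d$-simplex with barycentric coordinates $\lambda_0,\dots,\lambda_d$, and let $F_j$ be the face opposite to the $j$-th vertex. Write $\mathbb P_k(S_d)$, $\mathbb P_k(F_j)$ for the polynomials of total degree at most $k$ on $S_d$ and on $F_j$. Let $\alpha_0,\dots,\alpha_d>0$ be arbitrary, and let $\Omega_\alpha$ be the Dirichlet weight on $S_d$, i.e. $\prod_{i=0}^d\lambda_i^{\alpha_i-1}$ normalized to unit mass. Then $\Omega_\alpha$ is a probability density, positive almost everywhere on $S_d$, and for each $j$ the Dirichlet weight $\omega_{j}$ on $F_j$, i.e. $\prod_{i\ne j}\lambda_i^{\alpha_i-1}$ normalized to unit mass on $F_j$, is the induced face density: it is an almost everywhere positive probability density on $F_j$ and, for every continuous $\phi$ on $S_d$, $$\int_{F_j}\phi\,\omega_j\,dx=\lim_{\varepsilon\to0^+}\frac{\int_{S_d\cap\{\lambda_j<\varepsilon\}}\phi\,\Omega_\alpha\,d\sigma}{\int_{S_d\cap\{\lambda_j<\varepsilon\}}\Omega_\alpha\,d\sigma}.$$ Put $\langle f,g\rangle_\Omega=\int_{S_d}fg\,\Omega_\alpha\,d\sigma$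 and $\langle f,g\rangle_{\omega_j}=\int_{F_j}fg\,\omega_j\,dx$. Let $\mathbb S_2(S_d)$ be the orthogonal complement of $\mathbb P_1(S_d)$ in $\mathbb P_2(S_d)$ for $\langle\cdot,\cdot\rangle_\Omega$, and $\mathbb S_2(F_j)$ that of $\mathbb P_1(F_j)$ in $\mathbb P_2(F_j)$ for $\langle\cdot,\cdot\rangle_{\omega_j}$. Let $\tilde d=(d-2)(d+1)/2$. Call $(q_j)_{j=0}^d,(\rho_k)_{k=1}^{\tilde d},(\psi_j)_{j=0}^d$ admissible if $q_j\in\mathbb S_2(F_j)$ for all $j$, both families $(\rho_k)$ and $(\psi_j)$ are linearly independent, and $\mathbb S_2(S_d)=\mathbb V\oplus\mathbb W$ with $\mathbb V=\operatorname{span}\{\rho_k\}$, $\mathbb W=\operatorname{span}\{\psi_j\}$. For such a choice consider the functionals $$\mathcal I_j(f)=\langle f,1\rangle_{\omega_j},\quad \mathcal L_j(f)=\langle f,q_j\rangle_{\omega_j}\quad(0\le j\le d),\qquad \mathcal V_k(f)=\langle f,\rho_k\rangle_\Omega\quad(1\le k\le\tilde d),$$ and let $\Sigma=\{\mathcal I_j,\mathcal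 L_j,\mathcal V_k\}$. $\Sigma$ is unisolvent on $\mathbb P_2(S_d)$ if for all prescribed values of these functionals there is exactly one $p\in\mathbb P_2(S_d)$ attaining them. (i) There is an admissible choice for which $\Sigma$ is unisolvent on $\mathbb P_2(S_d)$; moreover it can be taken such that $(\rho_k)$ is orthonormal for $\langle\cdot,\cdot\rangle_\Omega$, $\mathbb V\perp\mathbb W$, and $\psi_j$ is the $\langle\cdot,\cdot\rangle_\Omega$-orthogonal projection of $\lambda_j\lambda_{j+1}$ onto $\mathbb S_2(S_d)$ for each $j$ (indices modulo $d+1$). (ii) For every admissible choice, $\Sigma$ is unisolvent on $\mathbb P_2(S_d)$ if and only if the $(d+1)\times(d+1)$ matrix $T=M-\tilde C G^{-1}C$ is invertible, where $[G]_{k\ell}=\mathcal V_k(\rho_\ell)$, $[C]_{ki}=\mathcal V_k(\psi_i)$, $[\tilde C]_{j\ell}=\mathcal L_j(\rho_\ell)$, $[M]_{ji}=\mathcal L_j(\psi_i)$. -/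

import Mathlib

open MeasureTheory Set Filter Topology

noncomputable section

namespace Histopolation

/-- The ambient Euclidean space of dimension `d`. -/
abbrev Pt (d : ℕ) : Type := EuclideanSpace ℝ (Fin d)

/-- The vertices of a nondegenerate `d`-simplex: `d + 1` affinely independent points of `ℝ^d`
(they then span the whole space). Its barycentric coordinates are the functions `b.coord i`. -/
abbrev Vertices (d : ℕ) : Type := AffineBasis (Fin (d + 1)) ℝ (Pt d)

variable {d : ℕ}

/-- The simplex `S_d`. -/
def simplex (b : Vertices d) : Set (Pt d) := convexHull ℝ (range b)

/-- The face `F_j` opposite to the vertex `b j`. -/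
def face (b : Vertices d) (j : Fin (d + 1)) : Set (Pt d) := convexHull ℝ (b '' {j}ᶜ)

/-- Lebesgue measure on the simplex. -/
def simplexMeasure (b : Vertices d) : Measure (Pt d) := volume.restrict (simplex b)

/-- The `(d - 1)`-dimensional surface measure on the face `F_j`. -/
def faceMeasure (b : Vertices d) (j : Fin (d + 1)) : Measure (Pt d) :=
  (Measure.euclideanHausdorffMeasure (d - 1)).restrict (face b j)

/-- The polynomials of total degree at most `k` in the barycentric coordinates `λ_i`, `i ∈ I`. -/
def polySpan (b : Vertices d) (I : Finset (Fin (d + 1))) (k : ℕ) : Submodule ℝ (Pt d → ℝ) :=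
  Submodule.span ℝ {f | ∃ n : Fin (d + 1) → ℕ, ∑ i ∈ I, n i ≤ k ∧
    f = fun x => ∏ i ∈ I, b.coord i x ^ n i}

/-- `ℙ_k(S_d)`. A polynomial on `S_d` is identified with the polynomial on `ℝ^d` extending it,
which is unique because `S_d` has nonempty interior. -/
def polySimplex (b : Vertices d) (k : ℕ) : Submodule ℝ (Pt d → ℝ) := polySpan b Finset.univ k

/-- `ℙ_k(F_j)`: the barycentric coordinates of `F_j` are the restrictions of `λ_i`, `i ≠ j`.
Only the values on `F_j` of an element are ever used. -/
def polyFace (b : Vertices d) (j : Fin (d + 1)) (k : ℕ) : Submodule ℝ (Pt d → ℝ) :=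
  polySpan b {j}ᶜ k

/-- The weighted pairing `∫ f g w dν`. -/
def wInner (ν : Measure (Pt d)) (w f g : Pt d → ℝ) : ℝ := ∫ x, f x * g x * w x ∂ν

/-- `w` is a probability density with respect to `ν`, positive almost everywhere. -/
structure IsPosProbDensity (ν : Measure (Pt d)) (w : Pt d → ℝ) : Prop where
  integrable : Integrable w ν
  integral_eq_one : ∫ x, w x ∂ν = 1
  pos : ∀ᵐ x ∂ν, 0 < w x

/-- The part of the simplex where `λ_j < ε`. -/
def collar (b : Vertices d) (j : Fin (d + 1)) (ε : ℝ) : Set (Pt d) :=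
  {x | x ∈ simplex b ∧ b.coord j x < ε}

/-- `w` is the face density on `F_j` induced by the density `Om` on the simplex: the normalized
conditional trace of `Om`. -/
structure IsInducedFaceDensity (b : Vertices d) (Om : Pt d → ℝ) (j : Fin (d + 1))
    (w : Pt d → ℝ) : Prop where
  density : IsPosProbDensity (faceMeasure b j) w
  tendsto : ∀ φ : Pt d → ℝ, ContinuousOn φ (simplex b) →
    Tendsto (fun ε : ℝ => (∫ x in collar b j ε, φ x * Om x) / ∫ x in collar b j ε, Om x)
      (𝓝[>] 0) (𝓝 (∫ x, φ x * w x ∂(faceMeasure b j)))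

/-- The unnormalized Dirichlet product `∏ λ_i ^ (α_i - 1)` over `i ∈ I`. -/
def dirichletProd (b : Vertices d) (α : Fin (d + 1) → ℝ) (I : Finset (Fin (d + 1)))
    (x : Pt d) : ℝ :=
  ∏ i ∈ I, b.coord i x ^ (α i - 1)

/-- The Dirichlet weight on the simplex, normalized to unit mass. -/
def dirichlet (b : Vertices d) (α : Fin (d + 1) → ℝ) (x : Pt d) : ℝ :=
  (∫ y, dirichletProd b α Finset.univ y ∂(simplexMeasure b))⁻¹ * dirichletProd b α Finset.univ x

/-- The Dirichlet weight on the face `F_j` with parameters `α_i`, `i ≠ j`, normalized to unit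
mass. -/
def dirichletFace (b : Vertices d) (α : Fin (d + 1) → ℝ) (j : Fin (d + 1)) (x : Pt d) : ℝ :=
  (∫ y, dirichletProd b α {j}ᶜ y ∂(faceMeasure b j))⁻¹ * dirichletProd b α {j}ᶜ x

/-- `𝕊_2(S_d)`: the quadratic polynomials orthogonal to `ℙ_1(S_d)` for the weight `Om`. -/
def quadSimplex (b : Vertices d) (Om : Pt d → ℝ) : Set (Pt d → ℝ) :=
  {p | p ∈ polySimplex b 2 ∧ ∀ φ ∈ polySimplex b 1, wInner (simplexMeasure b) Om p φ = 0}

/-- `𝕊_2(F_j)`: the quadratic polynomials on `F_j` orthogonal to `ℙ_1(F_j)` for the weight `w`. -/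
def quadFace (b : Vertices d) (j : Fin (d + 1)) (w : Pt d → ℝ) : Set (Pt d → ℝ) :=
  {q | q ∈ polyFace b j 2 ∧ ∀ φ ∈ polyFace b j 1, wInner (faceMeasure b j) w q φ = 0}

/-- The number `(d - 2)(d + 1) / 2` of interior functionals (used for `d ≥ 2`). -/
def numInterior (d : ℕ) : ℕ := (d - 2) * (d + 1) / 2

/-- The face average `I_j`. -/
def faceAvg (b : Vertices d) (om : Fin (d + 1) → Pt d → ℝ) (j : Fin (d + 1))
    (f : Pt d → ℝ) : ℝ :=
  wInner (faceMeasure b j) (om j) f 1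

/-- The face quadratic moment `L_j` with test function `q j`. -/
def faceMoment (b : Vertices d) (om q : Fin (d + 1) → Pt d → ℝ) (j : Fin (d + 1))
    (f : Pt d → ℝ) : ℝ :=
  wInner (faceMeasure b j) (om j) f (q j)

/-- The interior functional `V_k` with test function `ρ k`. -/
def interiorMoment (b : Vertices d) (Om : Pt d → ℝ) (ρ : Fin (numInterior d) → Pt d → ℝ)
    (k : Fin (numInterior d)) (f : Pt d → ℝ) : ℝ :=
  wInner (simplexMeasure b) Om f (ρ k)

/-- The degrees of freedom `Σ = {I_j, L_j, V_k}`, as a family of functionals. -/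
def dofs (b : Vertices d) (Om : Pt d → ℝ) (om q : Fin (d + 1) → Pt d → ℝ)
    (ρ : Fin (numInterior d) → Pt d → ℝ) :
    Fin (d + 1) ⊕ Fin (d + 1) ⊕ Fin (numInterior d) → (Pt d → ℝ) → ℝ :=
  Sum.elim (faceAvg b om) (Sum.elim (faceMoment b om q) (interiorMoment b Om ρ))

/-- A family of functionals is unisolvent on `P` if every choice of their values is attained by
exactly one element of `P`. -/
def IsUnisolvent {κ : Type*} (P : Submodule ℝ (Pt d → ℝ)) (L : κ → (Pt d → ℝ) → ℝ) : Prop :=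
  ∀ a : κ → ℝ, ∃! p : Pt d → ℝ, p ∈ P ∧ ∀ k, L k p = a k

/-- Admissible polynomials for the construction: the face test functions `q_j` lie in `𝕊_2(F_j)`,
and `𝕊_2(S_d) = 𝕍 ⊕ 𝕎`, where `ρ` is a basis of `𝕍` and `ψ` is a basis of `𝕎`. -/
structure IsAdmissible (b : Vertices d) (Om : Pt d → ℝ) (om q : Fin (d + 1) → Pt d → ℝ)
    (ρ : Fin (numInterior d) → Pt d → ℝ) (ψ : Fin (d + 1) → Pt d → ℝ) : Prop where
  test_mem : ∀ j, q j ∈ quadFace b j (om j)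
  linInd_interior : LinearIndependent ℝ ρ
  linInd_face : LinearIndependent ℝ ψ
  disjoint : Disjoint (Submodule.span ℝ (range ρ)) (Submodule.span ℝ (range ψ))
  sup_eq : ((Submodule.span ℝ (range ρ) ⊔ Submodule.span ℝ (range ψ) :
    Submodule ℝ (Pt d → ℝ)) : Set (Pt d → ℝ)) = quadSimplex b Om

/-- `[G]_{kl} = V_k(ρ_l)`. -/
def matG (b : Vertices d) (Om : Pt d → ℝ) (ρ : Fin (numInterior d) → Pt d → ℝ) :
    Matrix (Fin (numInterior d)) (Fin (numInterior d)) ℝ :=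
  Matrix.of fun k l => interiorMoment b Om ρ k (ρ l)

/-- `[C]_{ki} = V_k(ψ_i)`. -/
def matC (b : Vertices d) (Om : Pt d → ℝ) (ρ : Fin (numInterior d) → Pt d → ℝ)
    (ψ : Fin (d + 1) → Pt d → ℝ) : Matrix (Fin (numInterior d)) (Fin (d + 1)) ℝ :=
  Matrix.of fun k i => interiorMoment b Om ρ k (ψ i)

/-- `[C~]_{jl} = L_j(ρ_l)`. -/
def matCt (b : Vertices d) (om q : Fin (d + 1) → Pt d → ℝ)
    (ρ : Fin (numInterior d) → Pt d → ℝ) : Matrix (Fin (d + 1)) (Fin (numInterior d)) ℝ :=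
  Matrix.of fun j l => faceMoment b om q j (ρ l)

/-- `[M]_{ji} = L_j(ψ_i)`. -/
def matM (b : Vertices d) (om q ψ : Fin (d + 1) → Pt d → ℝ) :
    Matrix (Fin (d + 1)) (Fin (d + 1)) ℝ :=
  Matrix.of fun j i => faceMoment b om q j (ψ i)

/-- The Schur complement `T = M - C~ G⁻¹ C`. -/
def matT (b : Vertices d) (Om : Pt d → ℝ) (om q : Fin (d + 1) → Pt d → ℝ)
    (ρ : Fin (numInterior d) → Pt d → ℝ) (ψ : Fin (d + 1) → Pt d → ℝ) :
    Matrix (Fin (d + 1)) (Fin (d + 1)) ℝ :=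
  matM b om q ψ - matCt b om q ρ * (matG b Om ρ)⁻¹ * matC b Om ρ ψ

end Histopolation

end

/-!
# Unisolvence of weighted quadratic histopolation on a simplex

*Dirichlet weights.* Joining the points of a face `F_j` to the opposite vertex parametrizes the
simplex by `(t, z)`, with `t = λ_j` and `z ∈ F_j`, and turns Lebesgue measure into a multiple of
`(1 - t)^(d - 1) dt dz` (`exists_lintegral_simplex_eq`). In these coordinates the Dirichlet
distribution is the product of a Beta distribution in `t` and the Dirichlet distribution on the face
(`dirichletMeasure_eq_map`). By induction on the dimension this gives the integrability of the
weight. It also gives the limit over the collars `{λ_j < ε}`, which are products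
(`tendsto_collar_average`), and the means of the barycentric coordinates
(`integral_coord_dirichletMeasure`). A face of a `d`-simplex is treated as the isometric image of a
`(d - 1)`-simplex in its own right (`faceMap`).

*The Schur complement.* Quadratic polynomials are interpolated at the vertices and the midpoints of
the edges (`quadInterp_of_mem`). This determines the dimension of `ℙ_2(S_d)` and shows that a
polynomial vanishing on the simplex is zero, so that the pairing on `ℙ_2(S_d)` is definite. For an
admissible choice the barycentric coordinates, the `ψ_j` and the `ρ_k` form a basis of `ℙ_2(S_d)`, in
which the functionals have a block triangular matrix (`toMatrix_dofsLinearMap`). One diagonal block,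
`(I_j(λ_i))`, is invertible by the explicit means of the Dirichlet weights (`isUnit_faceAvg_coord`);
the other has the Schur complement `T` over the Gram matrix `G`.

*Existence.* The second difference of a quadratic polynomial along an edge vanishes on affine
functions, and for the edges of the cycle `b 0, b 1, …, b d` these functionals are dual to the
products `λ_i λ_{i+1}`. The edge from `b (j + 1)` to `b (j + 2)` lies in `F_j`, and the second
difference along it is the pairing with some `q_j ∈ 𝕊_2(F_j)`
(`exists_mem_quadFace_forall_wInner_eq_edgeDiff`). With `ψ_j` the projection of `λ_j λ_{j+1}` and `ρ`
an orthonormal basis of the orthogonal complement of the `ψ_j` in `𝕊_2(S_d)`, the matrix `C` vanishes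
and `T = M` is a permutation matrix.
-/

noncomputable section

namespace Histopolation

/-! ### Parametrization of a face by a simplex of one dimension less -/

theorem exists_face_isometry {n : ℕ} (b : Vertices (n + 1)) (j : Fin (n + 2)) :
    ∃ (f : Pt n →ᵃⁱ[ℝ] Pt (n + 1)) (b' : Vertices n), ∀ i, f (b' i) = b (j.succAbove i) := by
  have hind : AffineIndependent ℝ (fun i : Fin (n + 1) => b (j.succAbove i)) :=
    b.ind.comp_embedding j.succAboveEmb
  set W := vectorSpan ℝ (range fun i : Fin (n + 1) => b (j.succAbove i)) with hW
  have hfin : Module.finrank ℝ W = n := hind.finrank_vectorSpan (by simp)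
  let e : Pt n ≃ₗᵢ[ℝ] W :=
    ((stdOrthonormalBasis ℝ W).reindex (finCongr hfin)).repr.symm
  let p₀ : Pt (n + 1) := b (j.succAbove 0)
  let f : Pt n →ᵃⁱ[ℝ] Pt (n + 1) :=
    (AffineIsometryEquiv.constVAdd ℝ (Pt (n + 1)) p₀).toAffineIsometry.comp
      (W.subtypeₗᵢ.comp e.toLinearIsometry).toAffineIsometry
  have hf : ∀ x, f x = p₀ + (e x : Pt (n + 1)) := fun x => rfl
  have hmem : ∀ i, b (j.succAbove i) - p₀ ∈ W := fun i =>
    vsub_mem_vectorSpan ℝ (mem_range_self i) (mem_range_self 0)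
  let p : Fin (n + 1) → Pt n := fun i => e.symm ⟨_, hmem i⟩
  have hp : ∀ i, f (p i) = b (j.succAbove i) := fun i => by simp [hf, p]
  have hpi : AffineIndependent ℝ p := by
    refine AffineIndependent.of_comp f.toAffineMap ?_
    have hc : f.toAffineMap ∘ p = fun i => b (j.succAbove i) := funext hp
    rwa [hc]
  exact ⟨f, ⟨p, hpi, hpi.affineSpan_eq_top_iff_card_eq_finrank_add_one.2 (by simp)⟩, hp⟩

/-- An affine isometry of `ℝ^n` onto the hyperplane containing the face `F_j`. -/
def faceMap {n : ℕ} (b : Vertices (n + 1)) (j : Fin (n + 2)) : Pt n →ᵃⁱ[ℝ] Pt (n + 1) :=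
  (exists_face_isometry b j).choose

/-- The `n`-simplex which `faceMap b j` maps onto `F_j`; its vertices are numbered by omitting the
index `j`. -/
def faceVertices {n : ℕ} (b : Vertices (n + 1)) (j : Fin (n + 2)) : Vertices n :=
  (exists_face_isometry b j).choose_spec.choose

section Face

variable {n : ℕ} (b : Vertices (n + 1)) (j : Fin (n + 2))

theorem faceMap_faceVertices (i : Fin (n + 1)) :
    faceMap b j (faceVertices b j i) = b (j.succAbove i) :=
  (exists_face_isometry b j).choose_spec.choose_spec i

theorem coord_faceMap (k : Fin (n + 2)) (z : Pt n) :
    b.coord k (faceMap b j z) =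
      ∑ i, (faceVertices b j).coord i z * b.coord k (b (j.succAbove i)) := by
  have h := Finset.map_affineCombination Finset.univ (faceVertices b j)
    (fun i => (faceVertices b j).coord i z) ((faceVertices b j).sum_coord_apply_eq_one z)
    ((b.coord k).comp (faceMap b j).toAffineMap)
  rw [AffineBasis.affineCombination_coord_eq_self,
    Finset.affineCombination_eq_linear_combination _ _ _
      ((faceVertices b j).sum_coord_apply_eq_one z)] at h
  simpa [faceMap_faceVertices] using h

@[simp] theorem coord_faceMap_self (z : Pt n) : b.coord j (faceMap b j z) = 0 := by
  rw [coord_faceMap]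
  exact Finset.sum_eq_zero fun i _ => by
    rw [b.coord_apply_ne (Fin.succAbove_ne j i).symm, mul_zero]

@[simp] theorem coord_faceMap_succAbove (i : Fin (n + 1)) (z : Pt n) :
    b.coord (j.succAbove i) (faceMap b j z) = (faceVertices b j).coord i z := by
  rw [coord_faceMap, Finset.sum_eq_single i]
  · simp
  · intro k _ hk
    rw [b.coord_apply_ne (fun h => hk (Fin.succAbove_right_injective h).symm), mul_zero]
  · simp

theorem face_eq_image : face b j = faceMap b j '' simplex (faceVertices b j) := by
  have h := AffineMap.image_convexHull (faceMap b j).toAffineMap (range (faceVertices b j))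
  simp only [AffineIsometry.coe_toAffineMap] at h
  rw [simplex, h, face, ← range_comp]
  congr 1
  ext x
  simp only [mem_image, mem_compl_iff, mem_singleton_iff, mem_range, Function.comp,
    faceMap_faceVertices]
  constructor
  · rintro ⟨i, hi, rfl⟩
    obtain ⟨k, rfl⟩ := Fin.exists_succAbove_eq hi
    exact ⟨k, rfl⟩
  · rintro ⟨k, rfl⟩
    exact ⟨_, Fin.succAbove_ne j k, rfl⟩

theorem measurableEmbedding_faceMap : MeasurableEmbedding (faceMap b j) :=
  (faceMap b j).isometry.isClosedEmbedding.measurableEmbedding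

/-- The surface measure on `F_j` is the Lebesgue measure on a simplex of one dimension less, since
the normalized Hausdorff measure is invariant under isometries. -/
theorem faceMeasure_eq_map :
    faceMeasure b j = (simplexMeasure (faceVertices b j)).map (faceMap b j) := by
  have hr : face b j ⊆ range (faceMap b j) := by
    rw [face_eq_image]; exact image_subset_range _ _
  have h := (faceMap b j).isometry.map_euclideanHausdorffMeasure (d := n)
  rw [EuclideanSpace.euclideanHausdorffMeasure_eq_volume] at h
  rw [faceMeasure, simplexMeasure, Nat.add_sub_cancel, ← Measure.restrict_restrict_of_subset hr,
    ← h, (measurableEmbedding_faceMap b j).restrict_map, face_eq_image,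
    preimage_image_eq _ (faceMap b j).injective]

theorem integral_faceMeasure (f : Pt (n + 1) → ℝ) :
    ∫ x, f x ∂(faceMeasure b j) = ∫ z, f (faceMap b j z) ∂(simplexMeasure (faceVertices b j)) := by
  rw [faceMeasure_eq_map, (measurableEmbedding_faceMap b j).integral_map]

end Face

/-! ### Simplices -/

section Simplex

variable {d : ℕ} (b : Vertices d)

theorem mem_simplex {x : Pt d} : x ∈ simplex b ↔ ∀ i, 0 ≤ b.coord i x := by
  rw [simplex, b.convexHull_eq_nonneg_coord]; rfl

theorem isCompact_simplex : IsCompact (simplex b) :=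
  (finite_range b).isCompact_convexHull ℝ

theorem measurableSet_simplex : MeasurableSet (simplex b) :=
  (isCompact_simplex b).isClosed.measurableSet

theorem simplex_subset_closure_interior : simplex b ⊆ closure (interior (simplex b)) := by
  rw [simplex, (convex_convexHull ℝ _).closure_interior_eq_closure_of_nonempty_interior]
  · exact subset_closure
  · exact interior_convexHull_nonempty_iff_affineSpan_eq_top.2 b.tot

@[fun_prop] theorem continuous_coord (i : Fin (d + 1)) : Continuous (b.coord i) :=
  AffineMap.continuous_of_finiteDimensional _

instance : IsFiniteMeasure (simplexMeasure b) :=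
  isFiniteMeasure_restrict.2 (isCompact_simplex b).measure_lt_top.ne

instance : NeZero (simplexMeasure b) := ⟨by
  rw [simplexMeasure, Ne, Measure.restrict_eq_zero]
  exact (Measure.measure_pos_of_nonempty_interior _
    (interior_convexHull_nonempty_iff_affineSpan_eq_top.2 b.tot)).ne'⟩

theorem ae_coord_pos : ∀ᵐ x ∂(simplexMeasure b), ∀ i, 0 < b.coord i x := by
  have hnull : (volume : Measure (Pt d)) (frontier (simplex b)) = 0 :=
    (convex_convexHull ℝ _).addHaar_frontier _
  have h2 : ∀ᵐ x ∂(volume : Measure (Pt d)), x ∉ frontier (simplex b) :=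
    measure_eq_zero_iff_ae_notMem.1 hnull
  refine (ae_restrict_iff' (measurableSet_simplex b)).2 ?_
  filter_upwards [h2] with x hx hxS
  have : x ∈ interior (simplex b) := by
    by_contra h
    exact hx ⟨subset_closure hxS, h⟩
  rwa [simplex, b.interior_convexHull] at this

end Simplex

/-! ### Integration over a simplex along the segments from a face to the opposite vertex -/

section Cone

variable {n : ℕ} (b : Vertices (n + 1)) (j : Fin (n + 2))

/-- The point `(1 - t) x + t (b j)` on the segment from a point `x` of `F_j`, given by its parameter
`z` with `x = faceMap b j z`, to the vertex `b j`. Thus `t = λ_j`. -/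
def conePoint (p : ℝ × Pt n) : Pt (n + 1) := AffineMap.lineMap (faceMap b j p.2) (b j) p.1

@[fun_prop] theorem continuous_conePoint : Continuous (conePoint b j) := by
  have := (faceMap b j).isometry.continuous
  unfold conePoint
  simp only [AffineMap.lineMap_apply_module]
  fun_prop

@[simp] theorem coord_conePoint_self (p : ℝ × Pt n) : b.coord j (conePoint b j p) = p.1 := by
  rw [conePoint, AffineMap.apply_lineMap]
  simp [AffineMap.lineMap_apply]

@[simp] theorem coord_conePoint_succAbove (p : ℝ × Pt n) (i : Fin (n + 1)) :
    b.coord (j.succAbove i) (conePoint b j p) = (1 - p.1) * (faceVertices b j).coord i p.2 := by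
  rw [conePoint, AffineMap.apply_lineMap, b.coord_apply_ne (Fin.succAbove_ne j i)]
  simp [AffineMap.lineMap_apply]
  ring

theorem conePoint_mem_simplex_iff {t : ℝ} (ht : t ∈ Ioo (0 : ℝ) 1) (z : Pt n) :
    conePoint b j (t, z) ∈ simplex b ↔ z ∈ simplex (faceVertices b j) := by
  have h1 : 0 < 1 - t := by linarith [ht.2]
  simp only [mem_simplex, Fin.forall_iff_succAbove j, coord_conePoint_self,
    coord_conePoint_succAbove, ht.1.le, true_and, mul_nonneg_iff_of_pos_left h1]

/-- The affine chart `(t, w) ↦ f w + t u` behind `conePoint`, where `f` parametrizes the hyperplane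
of `F_j` and `u` points to the vertex `b j`. -/
def coneChart (p : ℝ × Pt n) : Pt (n + 1) := faceMap b j p.2 + p.1 • (b j - faceMap b j 0)

theorem conePoint_eq_coneChart (t : ℝ) (z : Pt n) :
    conePoint b j (t, z) = coneChart b j (t, (1 - t) • z) := by
  have h := (faceMap b j).toAffineMap.decomp
  have h1 : ∀ x, faceMap b j x = (faceMap b j).toAffineMap.linear x + faceMap b j 0 := fun x =>
    congrFun h x
  simp only [conePoint, coneChart, AffineMap.lineMap_apply_module]
  rw [h1 z, h1 ((1 - t) • z), map_smul]
  module

theorem exists_volume_eq_smul_map_coneChart :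
    Continuous (coneChart b j) ∧ ∃ c : ENNReal, c ≠ 0 ∧ c ≠ ⊤ ∧
      (volume : Measure (Pt (n + 1))) = c • (volume : Measure (ℝ × Pt n)).map (coneChart b j) := by
  have hcont : Continuous (coneChart b j) := by
    have := (faceMap b j).isometry.continuous
    unfold coneChart
    fun_prop
  refine ⟨hcont, ?_⟩
  let u := b j - faceMap b j 0
  let F := (faceMap b j).toAffineMap.linear
  have h1 : ∀ x, faceMap b j x = F x + faceMap b j 0 := fun x =>
    congrFun (faceMap b j).toAffineMap.decomp x
  let A : ℝ × Pt n →ₗ[ℝ] Pt (n + 1) :=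
    (LinearMap.toSpanSingleton ℝ _ u).coprod F
  have hA : ∀ p, coneChart b j p = A p + faceMap b j 0 := fun p => by
    simp only [coneChart, h1 p.2, A, LinearMap.coprod_apply, LinearMap.toSpanSingleton_apply, u]
    abel
  have hF : Function.Injective F := by
    have := (faceMap b j).linearIsometry.injective
    exact this
  have hcF : ∀ w, (b.coord j).linear (F w) = 0 := fun w => by
    have h2 : (b.coord j).linear (F w) = b.coord j (faceMap b j w) - b.coord j (faceMap b j 0) := by
      have : F w = faceMap b j w -ᵥ faceMap b j 0 := by rw [h1 w]; simp
      rw [this, AffineMap.linearMap_vsub]; rfl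
    rw [h2]; simp
  have hcu : (b.coord j).linear u = 1 := by
    have : u = b j -ᵥ faceMap b j 0 := rfl
    rw [this, AffineMap.linearMap_vsub]; simp
  have hinj : Function.Injective A := by
    rw [← LinearMap.ker_eq_bot, LinearMap.ker_eq_bot']
    rintro ⟨t, w⟩ h
    have h0 : t • u + F w = 0 := h
    have ht : t = 0 := by
      have := congrArg (b.coord j).linear h0
      rwa [map_add, map_smul, hcF, hcu, map_zero, smul_eq_mul, mul_one, add_zero] at this
    have hw : F w = 0 := by simpa [ht] using h0
    rw [ht, hF (hw.trans (map_zero F).symm)]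
    rfl
  let e : (ℝ × Pt n) ≃L[ℝ] Pt (n + 1) :=
    (LinearMap.linearEquivOfInjective A hinj (by simp; ring)).toContinuousLinearEquiv
  have he : ⇑e = A := rfl
  have hmap : (volume : Measure (ℝ × Pt n)).map (coneChart b j) =
      ((volume : Measure (ℝ × Pt n)).map e).map (fun x => x + faceMap b j 0) := by
    rw [Measure.map_map (by fun_prop) e.continuous.measurable]
    congr 1
    funext p
    simp [hA, he]
  have hprod : (volume : Measure (ℝ × Pt n)).IsAddHaarMeasure :=
    Measure.prod.instIsAddHaarMeasure volume volume
  have hhaar := e.isAddHaarMeasure_map (volume : Measure (ℝ × Pt n))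
  rw [hmap, map_add_right_eq_self]
  refine ⟨Measure.addHaarScalarFactor volume ((volume : Measure (ℝ × Pt n)).map e), ?_, ?_, ?_⟩
  · simpa using (Measure.addHaarScalarFactor_pos_of_isAddHaarMeasure _ _).ne'
  · simp
  · exact Measure.isAddLeftInvariant_eq_smul _ _

theorem lintegral_comp_smul_of_pos {n : ℕ} {r : ℝ} (hr : 0 < r) {g : Pt n → ENNReal}
    (hg : Measurable g) :
    ∫⁻ w, g w = ENNReal.ofReal (r ^ n) * ∫⁻ z, g (r • z) := by
  have h := Measure.map_addHaar_smul (volume : Measure (Pt n)) hr.ne'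
  rw [← lintegral_map hg (measurable_const_smul r), h, lintegral_smul_measure, smul_eq_mul,
    ← mul_assoc, ← ENNReal.ofReal_mul (by positivity), abs_of_pos (by positivity)]
  simp [mul_inv_cancel₀ (pow_pos hr n).ne']

/-- Lebesgue measure on the simplex in the coordinates `(t, z)` of `conePoint`: the slice at height
`t` is the face scaled by `1 - t`. -/
theorem exists_lintegral_simplex_eq :
    ∃ c : ENNReal, c ≠ 0 ∧ c ≠ ⊤ ∧ ∀ f : Pt (n + 1) → ENNReal, Measurable f →
      ∫⁻ x, f x ∂(simplexMeasure b) =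
        c * ∫⁻ t in Ioo (0 : ℝ) 1, ENNReal.ofReal ((1 - t) ^ n) *
          ∫⁻ z, f (conePoint b j (t, z)) ∂(simplexMeasure (faceVertices b j)) := by
  obtain ⟨hcont, c, hc0, hct, hc⟩ := exists_volume_eq_smul_map_coneChart b j
  refine ⟨c, hc0, hct, fun f hf => ?_⟩
  have hS := measurableSet_simplex b
  have hfS : Measurable ((simplex b).indicator f) := hf.indicator hS
  rw [simplexMeasure, ← lintegral_indicator hS, hc, lintegral_smul_measure, smul_eq_mul,
    lintegral_map hfS hcont.measurable, Measure.volume_eq_prod,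
    lintegral_prod (fun p => (simplex b).indicator f (coneChart b j p))
      (hfS.comp hcont.measurable).aemeasurable]
  congr 1
  have hcj : ∀ p, b.coord j (coneChart b j p) = p.1 := fun p => by
    by_cases h : p.1 = 1
    · have : coneChart b j p = (faceMap b j p.2 -ᵥ faceMap b j 0) +ᵥ b j := by
        simp [coneChart, h]; abel
      rw [this, AffineMap.map_vadd, AffineMap.linearMap_vsub]
      simp [h]
    · have h' : 1 - p.1 ≠ 0 := sub_ne_zero.2 (Ne.symm h)
      have := conePoint_eq_coneChart b j p.1 ((1 - p.1)⁻¹ • p.2)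
      rw [smul_inv_smul₀ h'] at this
      rw [← Prod.mk.eta (p := p), ← this, coord_conePoint_self]
  have hle : ∀ x ∈ simplex b, b.coord j x ≤ 1 := fun x hx => by
    rw [← b.sum_coord_apply_eq_one x]
    exact Finset.single_le_sum (fun i _ => (mem_simplex b).1 hx i) (Finset.mem_univ j)
  have hzero : ∀ t, t ∉ Icc (0 : ℝ) 1 →
      ∫⁻ w, (simplex b).indicator f (coneChart b j (t, w)) = 0 := fun t ht => by
    rw [← lintegral_zero (μ := (volume : Measure (Pt n)))]
    refine lintegral_congr fun w => indicator_of_notMem (fun hx => ht ?_) _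
    have h1 := (mem_simplex b).1 hx j
    have h2 := hle _ hx
    rw [hcj] at h1 h2
    exact ⟨h1, h2⟩
  rw [← setLIntegral_eq_of_support_subset (s := Icc (0 : ℝ) 1)
    (fun t ht => not_not.1 fun h => ht (hzero t h)), setLIntegral_congr Ioo_ae_eq_Icc.symm]
  refine setLIntegral_congr_fun measurableSet_Ioo fun t ht => ?_
  have h1 : 0 < 1 - t := by linarith [ht.2]
  have hm : Measurable fun w : Pt n => (simplex b).indicator f (coneChart b j (t, w)) :=
    hfS.comp (hcont.measurable.comp measurable_prodMk_left)
  beta_reduce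
  rw [lintegral_comp_smul_of_pos h1 hm, simplexMeasure,
    ← lintegral_indicator (measurableSet_simplex _)]
  congr 1
  refine lintegral_congr fun z => ?_
  rw [← conePoint_eq_coneChart]
  by_cases hz : z ∈ simplex (faceVertices b j)
  · rw [indicator_of_mem hz, indicator_of_mem ((conePoint_mem_simplex_iff b j ht z).2 hz)]
  · rw [indicator_of_notMem hz,
      indicator_of_notMem (fun h => hz ((conePoint_mem_simplex_iff b j ht z).1 h))]

end Cone

/-! ### Dirichlet measures -/

open ProbabilityTheory

theorem support_betaPDF_subset (a c : ℝ) : Function.support (betaPDF a c) ⊆ Ioo 0 1 := by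
  intro t ht
  by_contra h
  refine ht ?_
  by_cases h0 : t ≤ 0
  · exact betaPDF_eq_zero_of_nonpos h0
  · exact betaPDF_eq_zero_of_one_le (not_lt.1 fun h1 => h ⟨not_le.1 h0, h1⟩)

theorem measurable_betaPDF (a c : ℝ) : Measurable (betaPDF a c) :=
  (measurable_betaPDFReal _ _).ennreal_ofReal

theorem measurable_dirichletProd {d : ℕ} (b : Vertices d) (α : Fin (d + 1) → ℝ)
    (I : Finset (Fin (d + 1))) : Measurable (dirichletProd b α I) := by
  unfold dirichletProd
  refine Finset.measurable_prod _ fun i _ => ?_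
  exact (continuous_coord b i).measurable.pow_const _

theorem ae_dirichletProd_pos {d : ℕ} (b : Vertices d) (α : Fin (d + 1) → ℝ)
    (I : Finset (Fin (d + 1))) : ∀ᵐ x ∂(simplexMeasure b), 0 < dirichletProd b α I x := by
  filter_upwards [ae_coord_pos b] with x hx
  exact Finset.prod_pos fun i _ => Real.rpow_pos_of_pos (hx i) _

/-- The measure on the simplex with the unnormalized Dirichlet density. -/
def dirichletProdMeasure {d : ℕ} (b : Vertices d) (α : Fin (d + 1) → ℝ) : Measure (Pt d) :=
  (simplexMeasure b).withDensity fun x => ENNReal.ofReal (dirichletProd b α Finset.univ x)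

/-- The Dirichlet distribution on the simplex. -/
def dirichletMeasure {d : ℕ} (b : Vertices d) (α : Fin (d + 1) → ℝ) : Measure (Pt d) :=
  (simplexMeasure b).withDensity fun x => ENNReal.ofReal (dirichlet b α x)

instance {d : ℕ} (b : Vertices d) (α : Fin (d + 1) → ℝ) : SFinite (dirichletProdMeasure b α) := by
  unfold dirichletProdMeasure; infer_instance

/-- In the coordinates `(t, z)` the Dirichlet product separates. The factor `(1 - t) ^ n` of the
volume element is included, so that the exponents are those of the Beta density. -/
theorem dirichletProd_conePoint {n : ℕ} (b : Vertices (n + 1)) (j : Fin (n + 2))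
    (α : Fin (n + 2) → ℝ) {t : ℝ} (ht : t ∈ Ioo (0 : ℝ) 1) {z : Pt n}
    (hz : z ∈ simplex (faceVertices b j)) :
    (1 - t) ^ n * dirichletProd b α Finset.univ (conePoint b j (t, z)) =
      t ^ (α j - 1) * (1 - t) ^ (∑ i, α (j.succAbove i) - 1) *
        dirichletProd (faceVertices b j) (α ∘ j.succAbove) Finset.univ z := by
  have h1 : 0 < 1 - t := by linarith [ht.2]
  have hz' := (mem_simplex _).1 hz
  have hpow : (1 - t) ^ n * (1 - t) ^ (∑ i, (α (j.succAbove i) - 1)) =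
      (1 - t) ^ (∑ i, α (j.succAbove i) - 1) := by
    rw [← Real.rpow_natCast, ← Real.rpow_add h1]
    congr 1
    simp
    ring
  simp only [dirichletProd, Fin.prod_univ_succAbove _ j, coord_conePoint_self,
    coord_conePoint_succAbove, Real.mul_rpow h1.le (hz' _), Finset.prod_mul_distrib,
    Function.comp, ← Real.rpow_sum_of_pos h1]
  rw [← hpow]
  ring

theorem exists_dirichletProdMeasure_eq_smul_map {n : ℕ} (b : Vertices (n + 1)) (j : Fin (n + 2))
    (α : Fin (n + 2) → ℝ) (hα : ∀ i, 0 < α i) :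
    ∃ c : ENNReal, c ≠ 0 ∧ c ≠ ⊤ ∧ dirichletProdMeasure b α =
      c • ((betaMeasure (α j) (∑ i, α (j.succAbove i))).prod
        (dirichletProdMeasure (faceVertices b j) (α ∘ j.succAbove))).map (conePoint b j) := by
  obtain ⟨c, hc0, hct, hc⟩ := exists_lintegral_simplex_eq b j
  set A := ∑ i, α (j.succAbove i) with hA
  have hApos : 0 < A := Finset.sum_pos (fun i _ => hα _) Finset.univ_nonempty
  have hB : 0 < beta (α j) A := beta_pos (hα j) hApos
  refine ⟨c * ENNReal.ofReal (beta (α j) A), mul_ne_zero hc0 (by simpa using hB),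
    ENNReal.mul_ne_top hct ENNReal.ofReal_ne_top, ?_⟩
  refine Measure.ext_of_lintegral _ fun f hf => ?_
  have hw := (measurable_dirichletProd b α Finset.univ).ennreal_ofReal
  have hw' := (measurable_dirichletProd (faceVertices b j) (α ∘ j.succAbove)
    Finset.univ).ennreal_ofReal
  have hcone := (continuous_conePoint b j).measurable
  have hbm := measurable_betaPDF (α j) A
  have hsec : ∀ t, Measurable fun z => f (conePoint b j (t, z)) := fun t =>
    hf.comp (hcone.comp measurable_prodMk_left)
  have hsecm : Measurable fun t => ∫⁻ z, f (conePoint b j (t, z))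
      ∂(dirichletProdMeasure (faceVertices b j) (α ∘ j.succAbove)) :=
    (hf.comp hcone).lintegral_prod_right'
  rw [dirichletProdMeasure, lintegral_withDensity_eq_lintegral_mul _ hw hf,
    hc _ (hw.mul hf), lintegral_smul_measure, smul_eq_mul, mul_assoc, lintegral_map hf hcone,
    betaMeasure, lintegral_prod (fun p => f (conePoint b j p)) (hf.comp hcone).aemeasurable,
    lintegral_withDensity_eq_lintegral_mul _ hbm hsecm]
  congr 1
  have hsupp : (Function.support fun t => (betaPDF (α j) A * fun t => ∫⁻ z, f (conePoint b j (t, z))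
      ∂(dirichletProdMeasure (faceVertices b j) (α ∘ j.succAbove))) t) ⊆ Ioo (0 : ℝ) 1 :=
    fun t ht =>
    support_betaPDF_subset (α j) A fun h0 => ht (by simp [h0])
  rw [← setLIntegral_eq_of_support_subset hsupp, ← lintegral_const_mul' _ _ ENNReal.ofReal_ne_top]
  refine setLIntegral_congr_fun measurableSet_Ioo fun t ht => ?_
  have h1 : 0 < 1 - t := by linarith [ht.2]
  simp only [Pi.mul_apply, dirichletProdMeasure]
  rw [lintegral_withDensity_eq_lintegral_mul _ hw' (hsec t), betaPDF_of_pos_lt_one ht.1 ht.2,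
    ← mul_assoc, ← ENNReal.ofReal_mul hB.le, ← lintegral_const_mul' _ _ ENNReal.ofReal_ne_top,
    ← lintegral_const_mul' _ _ ENNReal.ofReal_ne_top]
  refine setLIntegral_congr_fun (measurableSet_simplex _) fun z hz => ?_
  have h := dirichletProd_conePoint b j α ht hz
  simp only [Pi.mul_apply]
  rw [← mul_assoc, ← mul_assoc, ← ENNReal.ofReal_mul (by positivity), h, ← ENNReal.ofReal_mul]
  · congr 3
    field_simp
    rw [hA]
  · have := Real.rpow_nonneg ht.1.le (α j - 1)
    have := Real.rpow_nonneg h1.le (A - 1)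
    positivity

theorem dirichletProdMeasure_univ_ne_zero {d : ℕ} (b : Vertices d) (α : Fin (d + 1) → ℝ) :
    dirichletProdMeasure b α univ ≠ 0 := by
  rw [dirichletProdMeasure, withDensity_apply _ MeasurableSet.univ, Measure.restrict_univ, Ne,
    lintegral_eq_zero_iff (measurable_dirichletProd b α _).ennreal_ofReal]
  intro h
  have : ∀ᵐ x ∂(simplexMeasure b), False := by
    filter_upwards [h, ae_dirichletProd_pos b α Finset.univ] with x hx hx'
    simp only [Pi.zero_apply, ENNReal.ofReal_eq_zero] at hx
    exact absurd hx' (not_lt.2 hx)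
  rw [eventually_false_iff_eq_bot, ae_eq_bot] at this
  exact NeZero.ne _ this

/-- The Dirichlet product is integrable, by induction on the dimension. -/
theorem isFiniteMeasure_dirichletProdMeasure {d : ℕ} (b : Vertices d) (α : Fin (d + 1) → ℝ)
    (hα : ∀ i, 0 < α i) : IsFiniteMeasure (dirichletProdMeasure b α) := by
  induction d with
  | zero =>
    have : dirichletProdMeasure b α = simplexMeasure b := by
      rw [dirichletProdMeasure]
      convert withDensity_one using 2
      funext x
      simp [dirichletProd, AffineBasis.coe_coord_of_subsingleton_eq_one]
    rw [this]
    infer_instance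
  | succ n ih =>
    obtain ⟨c, -, hct, hc⟩ := exists_dirichletProdMeasure_eq_smul_map b 0 α hα
    have := ih (faceVertices b 0) (α ∘ Fin.succAbove 0) fun i => hα _
    have := isProbabilityMeasureBeta (hα 0)
      (Finset.sum_pos (fun i _ => hα ((0 : Fin (n + 2)).succAbove i)) Finset.univ_nonempty)
    rw [hc]
    exact Measure.smul_finite _ hct

section Normalized

variable {d : ℕ} (b : Vertices d) (α : Fin (d + 1) → ℝ)

theorem integral_dirichletProd :
    ∫ x, dirichletProd b α Finset.univ x ∂(simplexMeasure b) =
      (dirichletProdMeasure b α univ).toReal := by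
  rw [integral_eq_lintegral_of_nonneg_ae
    ((ae_dirichletProd_pos b α _).mono fun x hx => hx.le)
    (measurable_dirichletProd b α _).aestronglyMeasurable, dirichletProdMeasure,
    withDensity_apply _ MeasurableSet.univ, Measure.restrict_univ]

theorem measurable_dirichlet : Measurable (dirichlet b α) :=
  (measurable_dirichletProd b α _).const_mul _

theorem dirichletMeasure_eq_smul (hα : ∀ i, 0 < α i) :
    dirichletMeasure b α = (dirichletProdMeasure b α univ)⁻¹ • dirichletProdMeasure b α := by
  have := isFiniteMeasure_dirichletProdMeasure b α hα
  have h0 := dirichletProdMeasure_univ_ne_zero b α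
  have hpos : 0 < (dirichletProdMeasure b α univ).toReal :=
    ENNReal.toReal_pos h0 (measure_ne_top _ _)
  rw [dirichletMeasure]
  nth_rw 2 [dirichletProdMeasure]
  rw [← withDensity_smul _ (measurable_dirichletProd b α _).ennreal_ofReal]
  congr 1
  funext x
  rw [dirichlet, integral_dirichletProd, ENNReal.ofReal_mul (by positivity),
    ENNReal.ofReal_inv_of_pos hpos, ENNReal.ofReal_toReal (measure_ne_top _ _)]
  rfl

theorem isProbabilityMeasure_dirichletMeasure (hα : ∀ i, 0 < α i) :
    IsProbabilityMeasure (dirichletMeasure b α) := by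
  have := isFiniteMeasure_dirichletProdMeasure b α hα
  refine ⟨?_⟩
  rw [dirichletMeasure_eq_smul b α hα, Measure.smul_apply, smul_eq_mul,
    ENNReal.inv_mul_cancel (dirichletProdMeasure_univ_ne_zero b α) (measure_ne_top _ _)]

theorem ae_dirichlet_pos (hα : ∀ i, 0 < α i) :
    ∀ᵐ x ∂(simplexMeasure b), 0 < dirichlet b α x := by
  have := isFiniteMeasure_dirichletProdMeasure b α hα
  filter_upwards [ae_dirichletProd_pos b α Finset.univ] with x hx
  rw [dirichlet, integral_dirichletProd]
  exact mul_pos (inv_pos.2 (ENNReal.toReal_pos (dirichletProdMeasure_univ_ne_zero b α)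
    (measure_ne_top _ _))) hx

theorem setIntegral_dirichletMeasure (hα : ∀ i, 0 < α i) (f : Pt d → ℝ) {s : Set (Pt d)}
    (hs : MeasurableSet s) :
    ∫ x in s, f x ∂(dirichletMeasure b α) =
      ∫ x in s, f x * dirichlet b α x ∂(simplexMeasure b) := by
  rw [dirichletMeasure, restrict_withDensity hs, integral_withDensity_eq_integral_toReal_smul
    (measurable_dirichlet b α).ennreal_ofReal (by simp)]
  refine integral_congr_ae (ae_restrict_of_ae ?_)
  filter_upwards [ae_dirichlet_pos b α hα] with x hx
  rw [ENNReal.toReal_ofReal hx.le, smul_eq_mul, mul_comm]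

theorem integral_mul_dirichlet (hα : ∀ i, 0 < α i) (f : Pt d → ℝ) :
    ∫ x, f x * dirichlet b α x ∂(simplexMeasure b) = ∫ x, f x ∂(dirichletMeasure b α) := by
  simpa using (setIntegral_dirichletMeasure b α hα f MeasurableSet.univ).symm

theorem integrable_dirichlet (hα : ∀ i, 0 < α i) :
    Integrable (dirichlet b α) (simplexMeasure b) := by
  have := isProbabilityMeasure_dirichletMeasure b α hα
  refine ⟨(measurable_dirichlet b α).aestronglyMeasurable, ?_⟩
  rw [hasFiniteIntegral_iff_ofReal ((ae_dirichlet_pos b α hα).mono fun x hx => hx.le)]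
  have : dirichletMeasure b α univ < ⊤ := measure_lt_top _ _
  rwa [dirichletMeasure, withDensity_apply _ MeasurableSet.univ, Measure.restrict_univ] at this

theorem isPosProbDensity_dirichlet (hα : ∀ i, 0 < α i) :
    IsPosProbDensity (simplexMeasure b) (dirichlet b α) where
  integrable := integrable_dirichlet b α hα
  integral_eq_one := by
    have := isProbabilityMeasure_dirichletMeasure b α hα
    simpa using integral_mul_dirichlet b α hα fun _ => 1
  pos := ae_dirichlet_pos b α hα

theorem ae_dirichletMeasure_mem_simplex : ∀ᵐ x ∂(dirichletMeasure b α), x ∈ simplex b :=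
  (withDensity_absolutelyContinuous _ _).ae_le (ae_restrict_mem (measurableSet_simplex b))

end Normalized

/-- The barycentric coordinate `λ_j` of a Dirichlet distributed point is Beta distributed, and
independently of it the projection of the point from the vertex `b j` to `F_j` is again Dirichlet
distributed. -/
theorem dirichletMeasure_eq_map {n : ℕ} (b : Vertices (n + 1)) (j : Fin (n + 2))
    (α : Fin (n + 2) → ℝ) (hα : ∀ i, 0 < α i) :
    dirichletMeasure b α =
      ((betaMeasure (α j) (∑ i, α (j.succAbove i))).prod
        (dirichletMeasure (faceVertices b j) (α ∘ j.succAbove))).map (conePoint b j) := by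
  obtain ⟨c, -, -, hc⟩ := exists_dirichletProdMeasure_eq_smul_map b j α hα
  have hα' : ∀ i, 0 < (α ∘ j.succAbove) i := fun i => hα _
  have := isProbabilityMeasure_dirichletMeasure (faceVertices b j) _ hα'
  have := isProbabilityMeasureBeta (hα j)
    (Finset.sum_pos (fun i _ => hα (j.succAbove i)) Finset.univ_nonempty)
  have := isFiniteMeasure_dirichletProdMeasure b α hα
  have := isFiniteMeasure_dirichletProdMeasure (faceVertices b j) _ hα'
  have h0 := dirichletProdMeasure_univ_ne_zero b α
  set k := dirichletProdMeasure (faceVertices b j) (α ∘ j.succAbove) univ with hk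
  have hk0 : k ≠ 0 := dirichletProdMeasure_univ_ne_zero _ _
  have hD : dirichletProdMeasure (faceVertices b j) (α ∘ j.succAbove) =
      k • dirichletMeasure (faceVertices b j) (α ∘ j.succAbove) := by
    rw [dirichletMeasure_eq_smul _ _ hα', smul_smul, ENNReal.mul_inv_cancel hk0
      (measure_ne_top _ _), one_smul]
  rw [hD, Measure.prod_smul_right, Measure.map_smul, smul_smul] at hc
  have hcone := (continuous_conePoint b j).measurable
  have := Measure.isProbabilityMeasure_map (μ := (betaMeasure (α j) (∑ i, α (j.succAbove i))).prod
        (dirichletMeasure (faceVertices b j) (α ∘ j.succAbove))) hcone.aemeasurable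
  have hu : dirichletProdMeasure b α univ = c * k := by
    rw [hc, Measure.smul_apply, measure_univ, smul_eq_mul, mul_one]
  rw [dirichletMeasure_eq_smul b α hα, hu, hc, smul_smul, ENNReal.inv_mul_cancel, one_smul]
  · rw [← hu]; exact h0
  · rw [← hu]; exact measure_ne_top _ _

/-- The mean of the Beta distribution. -/
theorem integral_betaMeasure_id {a c : ℝ} (ha : 0 < a) (hc : 0 < c) :
    ∫ t, t ∂(betaMeasure a c) = a / (a + c) := by
  have hpdf : ∀ t, (betaPDF a c t).toReal • t = a / (a + c) * betaPDFReal (a + 1) c t := by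
    intro t
    by_cases ht : 0 < t ∧ t < 1
    · have h := betaPDFReal_pos ht.1 ht.2 ha hc
      have hG := (Real.Gamma_pos_of_pos ha).ne'
      have hG' := (Real.Gamma_pos_of_pos hc).ne'
      have hG'' := (Real.Gamma_pos_of_pos (add_pos ha hc)).ne'
      have hac : a + c ≠ 0 := (add_pos ha hc).ne'
      rw [betaPDF, ENNReal.toReal_ofReal h.le, betaPDFReal, betaPDFReal, if_pos ht, if_pos ht,
        beta, beta, show a + 1 + c = (a + c) + 1 by ring, Real.Gamma_add_one ha.ne',
        Real.Gamma_add_one hac, show a + 1 - 1 = (a - 1) + 1 by ring,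
        Real.rpow_add_one ht.1.ne', smul_eq_mul]
      field_simp
    · simp [betaPDF, betaPDFReal, ht]
  have hone : ∫ t, betaPDFReal (a + 1) c t = 1 := by
    rw [integral_eq_lintegral_of_nonneg_ae _ (by fun_prop)]
    · have := lintegral_betaPDF_eq_one (add_pos ha one_pos) hc
      simp only [betaPDF] at this
      rw [this]; rfl
    · refine Eventually.of_forall fun t => ?_
      by_cases ht : 0 < t ∧ t < 1
      · exact (betaPDFReal_pos ht.1 ht.2 (add_pos ha one_pos) hc).le
      · simp [betaPDFReal, ht]
  rw [betaMeasure, integral_withDensity_eq_integral_toReal_smul (measurable_betaPDF a c)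
    (by simp [betaPDF])]
  simp only [hpdf]
  rw [integral_const_mul, hone, mul_one]

/-- The barycentric coordinates have the means `α_j / ∑ α_i` under a Dirichlet distribution. -/
theorem integral_coord_dirichletMeasure {n : ℕ} (b : Vertices (n + 1)) (j : Fin (n + 2))
    (α : Fin (n + 2) → ℝ) (hα : ∀ i, 0 < α i) :
    ∫ x, b.coord j x ∂(dirichletMeasure b α) = α j / ∑ i, α i := by
  have hA : 0 < ∑ i, α (j.succAbove i) :=
    Finset.sum_pos (fun i _ => hα (j.succAbove i)) Finset.univ_nonempty
  have := isProbabilityMeasure_dirichletMeasure (faceVertices b j) (α ∘ j.succAbove)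
    fun i => hα _
  have := isProbabilityMeasureBeta (hα j) hA
  rw [dirichletMeasure_eq_map b j α hα, integral_map (continuous_conePoint b j).aemeasurable
    (continuous_coord b j).aestronglyMeasurable]
  simp only [coord_conePoint_self]
  rw [integral_fun_fst (fun t => t), integral_betaMeasure_id (hα j) hA, Fin.sum_univ_succAbove _ j]
  simp

/-! ### The face densities and the collar limit -/

theorem ae_betaMeasure_mem_Ioo (a c : ℝ) : ∀ᵐ t ∂(betaMeasure a c), t ∈ Ioo (0 : ℝ) 1 := by
  rw [betaMeasure, ae_withDensity_iff (measurable_betaPDF a c)]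
  exact Eventually.of_forall fun t ht => support_betaPDF_subset a c ht

theorem betaMeasure_Iio_ne_zero {a c : ℝ} (ha : 0 < a) (hc : 0 < c) {ε : ℝ} (hε : 0 < ε) :
    betaMeasure a c (Iio ε) ≠ 0 := by
  rw [betaMeasure, Ne, withDensity_apply_eq_zero (measurable_betaPDF a c)]
  intro h
  have hsub : Ioo 0 (min ε 1) ⊆ {t | betaPDF a c t ≠ 0} ∩ Iio ε := fun t ht => by
    have h1 := lt_min_iff.1 ht.2
    refine ⟨?_, h1.1⟩
    have := betaPDFReal_pos ht.1 h1.2 ha hc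
    simpa [betaPDF] using this
  have := measure_mono_null hsub h
  simp only [Real.volume_Ioo, ENNReal.ofReal_eq_zero] at this
  have : 0 < min ε 1 := lt_min hε one_pos
  linarith

section

variable {n : ℕ} (b : Vertices (n + 1)) (j : Fin (n + 2)) (α : Fin (n + 2) → ℝ)

theorem dirichletProd_faceMap (z : Pt n) :
    dirichletProd b α {j}ᶜ (faceMap b j z) =
      dirichletProd (faceVertices b j) (α ∘ j.succAbove) Finset.univ z := by
  rw [dirichletProd, ← Fin.image_succAbove_univ,
    Finset.prod_image fun i _ k _ h => Fin.succAbove_right_injective h]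
  simp [dirichletProd]

theorem dirichletFace_faceMap (z : Pt n) :
    dirichletFace b α j (faceMap b j z) =
      dirichlet (faceVertices b j) (α ∘ j.succAbove) z := by
  simp only [dirichletFace, dirichlet, integral_faceMeasure, dirichletProd_faceMap]

variable {α}

theorem integral_mul_dirichletFace (hα : ∀ i, 0 < α i) (f : Pt (n + 1) → ℝ) :
    ∫ x, f x * dirichletFace b α j x ∂(faceMeasure b j) =
      ∫ z, f (faceMap b j z) ∂(dirichletMeasure (faceVertices b j) (α ∘ j.succAbove)) := by
  simp only [integral_faceMeasure, dirichletFace_faceMap]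
  exact integral_mul_dirichlet _ _ (fun i => hα _) fun z => f (faceMap b j z)

theorem isPosProbDensity_dirichletFace (hα : ∀ i, 0 < α i) :
    IsPosProbDensity (faceMeasure b j) (dirichletFace b α j) := by
  have h := isPosProbDensity_dirichlet (faceVertices b j) (α ∘ j.succAbove) fun i => hα _
  have he : dirichletFace b α j ∘ faceMap b j =
      dirichlet (faceVertices b j) (α ∘ j.succAbove) := funext (dirichletFace_faceMap b j α)
  refine ⟨?_, ?_, ?_⟩
  · rw [faceMeasure_eq_map, (measurableEmbedding_faceMap b j).integrable_map_iff, he]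
    exact h.integrable
  · simpa only [integral_faceMeasure, dirichletFace_faceMap] using h.integral_eq_one
  · rw [faceMeasure_eq_map, (measurableEmbedding_faceMap b j).ae_map_iff]
    simpa only [dirichletFace_faceMap] using h.pos

theorem faceMap_mem_simplex {z : Pt n} (hz : z ∈ simplex (faceVertices b j)) :
    faceMap b j z ∈ simplex b := by
  rw [mem_simplex] at hz ⊢
  simpa [Fin.forall_iff_succAbove j] using hz

theorem setIntegral_collar (hα : ∀ i, 0 < α i) {φ : Pt (n + 1) → ℝ} (hφ : Continuous φ) (ε : ℝ) :
    ∫ x in collar b j ε, φ x * dirichlet b α x =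
      ∫ p in Iio ε ×ˢ univ, φ (conePoint b j p)
        ∂((betaMeasure (α j) (∑ i, α (j.succAbove i))).prod
          (dirichletMeasure (faceVertices b j) (α ∘ j.succAbove))) := by
  have hm : MeasurableSet {x | b.coord j x < ε} :=
    measurableSet_lt (continuous_coord b j).measurable measurable_const
  have hc : collar b j ε = {x | b.coord j x < ε} ∩ simplex b := by
    ext x; exact and_comm
  rw [hc, ← Measure.restrict_restrict hm]
  change ∫ x in _, _ ∂(simplexMeasure b) = _
  rw [← setIntegral_dirichletMeasure b α hα φ hm, dirichletMeasure_eq_map b j α hα,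
    setIntegral_map hm hφ.aestronglyMeasurable (continuous_conePoint b j).aemeasurable]
  congr 2
  ext p
  simp

/-- Averages over the collars `{λ_j < ε}` converge to the average over the face: a collar is the
product of a short interval in `t` with the face, and `φ (conePoint (t, z))` is close to its value
at `t = 0`, uniformly in `z`. -/
theorem tendsto_collar_average (hα : ∀ i, 0 < α i) {φ : Pt (n + 1) → ℝ} (hφ : Continuous φ) :
    Tendsto (fun ε : ℝ => (∫ x in collar b j ε, φ x * dirichlet b α x) /
        ∫ x in collar b j ε, dirichlet b α x) (𝓝[>] 0)
      (𝓝 (∫ x, φ x * dirichletFace b α j x ∂(faceMeasure b j))) := by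
  have hA : 0 < ∑ i, α (j.succAbove i) :=
    Finset.sum_pos (fun i _ => hα (j.succAbove i)) Finset.univ_nonempty
  have hν := isProbabilityMeasure_dirichletMeasure (faceVertices b j) (α ∘ j.succAbove)
    fun i => hα _
  have hβ := isProbabilityMeasureBeta (hα j) hA
  rw [integral_mul_dirichletFace b j hα]
  have hone : ∀ ε, ∫ x in collar b j ε, dirichlet b α x =
      ∫ x in collar b j ε, (fun _ => (1 : ℝ)) x * dirichlet b α x := by simp
  simp only [hone, setIntegral_collar b j hα hφ, setIntegral_collar b j hα continuous_const]
  set β := betaMeasure (α j) (∑ i, α (j.succAbove i)) with hβdef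
  set ν := dirichletMeasure (faceVertices b j) (α ∘ j.succAbove) with hνdef
  have haeIoo : ∀ᵐ p ∂(β.prod ν), p.1 ∈ Ioo (0 : ℝ) 1 :=
    Measure.quasiMeasurePreserving_fst.ae (ae_betaMeasure_mem_Ioo _ _)
  have haeS : ∀ᵐ p ∂(β.prod ν), p.2 ∈ simplex (faceVertices b j) :=
    Measure.quasiMeasurePreserving_snd.ae (ae_dirichletMeasure_mem_simplex _ _)
  have hcompact := isCompact_simplex b
  obtain ⟨C, hC⟩ := hcompact.exists_bound_of_continuousOn hφ.continuousOn
  have hfc := (faceMap b j).isometry.continuous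
  have hi1 : Integrable (fun p => φ (conePoint b j p)) (β.prod ν) := by
    refine Integrable.of_bound (hφ.comp (continuous_conePoint b j)).aestronglyMeasurable C ?_
    filter_upwards [haeIoo, haeS] with p hp1 hp2
    exact hC _ ((conePoint_mem_simplex_iff b j hp1 p.2).2 hp2)
  have hi2 : Integrable (fun p : ℝ × Pt n => φ (faceMap b j p.2)) (β.prod ν) := by
    refine Integrable.of_bound (hφ.comp (hfc.comp continuous_snd)).aestronglyMeasurable C ?_
    filter_upwards [haeS] with p hp2
    exact hC _ (faceMap_mem_simplex b j hp2)
  -- the distance from `conePoint (t, z)` to `faceMap z` is at most `t * R`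
  obtain ⟨R, hR⟩ := hcompact.isBounded.subset_closedBall (b j)
  rw [Metric.tendsto_nhds]
  intro δ hδ
  obtain ⟨η, hη, hηφ⟩ := Metric.uniformContinuousOn_iff.1
    (hcompact.uniformContinuousOn_of_continuous hφ.continuousOn) (δ / 2) (half_pos hδ)
  have hR1 : 0 < |R| + 1 := by positivity
  filter_upwards [Ioo_mem_nhdsGT (div_pos hη hR1)] with ε hε
  have hD : 0 < β.real (Iio ε) :=
    ENNReal.toReal_pos (betaMeasure_Iio_ne_zero (hα j) hA hε.1) (measure_ne_top _ _)
  have hden : ∫ p in Iio ε ×ˢ (univ : Set (Pt n)), (1 : ℝ) ∂(β.prod ν) = β.real (Iio ε) := by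
    simp [measureReal_prod_prod]
  have hlim : ∫ p in Iio ε ×ˢ (univ : Set (Pt n)), φ (faceMap b j p.2) ∂(β.prod ν) =
      β.real (Iio ε) * ∫ z, φ (faceMap b j z) ∂ν := by
    have h := setIntegral_prod_mul (μ := β) (ν := ν) (fun _ => (1 : ℝ))
      (fun z => φ (faceMap b j z)) (Iio ε) univ
    simpa using h
  have hdiff : ‖∫ p in Iio ε ×ˢ (univ : Set (Pt n)),
      (φ (conePoint b j p) - φ (faceMap b j p.2)) ∂(β.prod ν)‖ ≤
      δ / 2 * (β.prod ν).real (Iio ε ×ˢ univ) := by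
    refine norm_setIntegral_le_of_norm_le_const_ae' (measure_lt_top _ _) ?_
    filter_upwards [haeIoo, haeS] with p hp1 hp2 hp
    have hfS := faceMap_mem_simplex b j hp2
    refine (hηφ _ ((conePoint_mem_simplex_iff b j hp1 p.2).2 hp2) _ hfS ?_).le
    change dist (AffineMap.lineMap (faceMap b j p.2) (b j) p.1) _ < η
    have hpε : p.1 < ε := hp.1
    have h1 : dist (faceMap b j p.2) (b j) ≤ R := hR hfS
    rw [dist_lineMap_left, Real.norm_of_nonneg hp1.1.le]
    calc p.1 * dist (faceMap b j p.2) (b j) ≤ p.1 * (|R| + 1) := by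
          gcongr
          · exact hp1.1.le
          · linarith [le_abs_self R]
      _ < η / (|R| + 1) * (|R| + 1) := by
          gcongr
          exact hpε.trans hε.2
      _ = η := div_mul_cancel₀ _ hR1.ne'
  rw [integral_sub hi1.integrableOn hi2.integrableOn, hlim, measureReal_prod_prod,
    probReal_univ, mul_one] at hdiff
  rw [hden, Real.dist_eq, div_sub' hD.ne', abs_div, abs_of_pos hD, div_lt_iff₀ hD]
  calc _ ≤ δ / 2 * β.real (Iio ε) := hdiff
    _ < δ * β.real (Iio ε) := by gcongr; linarith

/-- The test functions `φ` of the definition are continuous on the simplex only, and are extended to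
the whole space by the Tietze theorem. -/
theorem isInducedFaceDensity_dirichletFace (hα : ∀ i, 0 < α i) :
    IsInducedFaceDensity b (dirichlet b α) j (dirichletFace b α j) where
  density := isPosProbDensity_dirichletFace b j hα
  tendsto φ hφ := by
    obtain ⟨g, hg⟩ := ContinuousMap.exists_restrict_eq (isCompact_simplex b).isClosed
      ⟨_, continuousOn_iff_continuous_domRestrict.1 hφ⟩
    have hgφ : ∀ x ∈ simplex b, g x = φ x := fun x hx =>
      congrArg (fun h : C(simplex b, ℝ) => h ⟨x, hx⟩) hg
    have h := tendsto_collar_average b j hα g.continuous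
    have hcm : ∀ ε, MeasurableSet (collar b j ε) := fun ε =>
      (measurableSet_simplex b).inter
        (measurableSet_lt (continuous_coord b j).measurable measurable_const)
    have h1 : ∀ ε, ∫ x in collar b j ε, g x * dirichlet b α x =
        ∫ x in collar b j ε, φ x * dirichlet b α x := fun ε =>
      setIntegral_congr_fun (hcm ε) fun x hx => by simp only [hgφ x hx.1]
    have hfm : MeasurableSet (face b j) := by
      rw [face_eq_image]
      exact (measurableEmbedding_faceMap b j).measurableSet_image.2 (measurableSet_simplex _)
    have hfs : face b j ⊆ simplex b := convexHull_mono (image_subset_range _ _)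
    have h2 : ∫ x, g x * dirichletFace b α j x ∂(faceMeasure b j) =
        ∫ x, φ x * dirichletFace b α j x ∂(faceMeasure b j) :=
      setIntegral_congr_fun hfm fun x hx => by simp only [hgφ x (hfs hx)]
    simpa only [h1, h2] using h

theorem integral_coord_mul_dirichletFace {n : ℕ} (b : Vertices (n + 2)) (j : Fin (n + 3))
    {α : Fin (n + 3) → ℝ} (hα : ∀ i, 0 < α i) (i : Fin (n + 3)) :
    ∫ x, b.coord i x * dirichletFace b α j x ∂(faceMeasure b j) =
      if i = j then 0 else α i / (∑ k, α k - α j) := by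
  rw [integral_mul_dirichletFace b j hα]
  split_ifs with h
  · simp [h]
  · obtain ⟨k, rfl⟩ := Fin.exists_succAbove_eq h
    simp only [coord_faceMap_succAbove]
    rw [integral_coord_dirichletMeasure _ _ (α ∘ j.succAbove) fun i => hα _,
      Fin.sum_univ_succAbove α j]
    simp

end

/-! ### Quadratic polynomials in barycentric coordinates -/

section Poly

variable {d : ℕ} (b : Vertices d)

theorem continuous_of_mem_polySpan {I : Finset (Fin (d + 1))} {k : ℕ} {p : Pt d → ℝ}
    (hp : p ∈ polySpan b I k) : Continuous p := by
  induction hp using Submodule.span_induction with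
  | mem p hp =>
    obtain ⟨n, -, rfl⟩ := hp
    fun_prop
  | zero => exact continuous_const
  | add p q _ _ hp hq => exact hp.add hq
  | smul c p _ hp => exact hp.const_smul c

theorem polySpan_mono (I : Finset (Fin (d + 1))) {k l : ℕ} (hkl : k ≤ l) :
    polySpan b I k ≤ polySpan b I l :=
  Submodule.span_mono fun _ ⟨n, hn, hf⟩ => ⟨n, hn.trans hkl, hf⟩

theorem coord_mem_polySpan {I : Finset (Fin (d + 1))} {i : Fin (d + 1)} (hi : i ∈ I) :
    (fun x => b.coord i x) ∈ polySpan b I 1 := by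
  refine Submodule.subset_span ⟨Pi.single i 1, ?_, ?_⟩
  · simp [hi]
  · funext x
    simp [Pi.single_apply, pow_ite, hi]

theorem coord_mul_coord_mem_polySimplex (i k : Fin (d + 1)) :
    (fun x => b.coord i x * b.coord k x) ∈ polySimplex b 2 := by
  refine Submodule.subset_span ⟨Pi.single i 1 + Pi.single k 1, ?_, ?_⟩
  · simp [Finset.sum_add_distrib]
  · funext x
    simp only [Pi.add_apply, pow_add, Finset.prod_mul_distrib]
    simp [Pi.single_apply, pow_ite]

/-- A monomial of degree at most `k + 1` is an affine function times a monomial of degree at most `k`.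
Hence `ℙ_2(S_d)` is spanned by products of two affine functions. -/
theorem exists_affine_mul_monomial {k : ℕ} (n : Fin (d + 1) → ℕ) (hn : ∑ i, n i ≤ k + 1) :
    ∃ (g : Pt d →ᵃ[ℝ] ℝ) (m : Fin (d + 1) → ℕ), ∑ i, m i ≤ k ∧
      ∀ x, ∏ i, b.coord i x ^ n i = g x * ∏ i, b.coord i x ^ m i := by
  by_cases h : ∀ i, n i = 0
  · exact ⟨AffineMap.const ℝ _ 1, 0, by simp, fun x => by simp [h]⟩
  · push Not at h
    obtain ⟨i, hi⟩ := h
    refine ⟨b.coord i, Function.update n i (n i - 1), ?_, fun x => ?_⟩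
    · have h1 := Fintype.sum_eq_add_sum_compl i n
      rw [Fintype.sum_eq_add_sum_compl i]
      have : ∑ l ∈ {i}ᶜ, Function.update n i (n i - 1) l = ∑ l ∈ {i}ᶜ, n l :=
        Finset.sum_congr rfl fun l hl => by
          rw [Function.update_of_ne]; simpa using hl
      rw [this, Function.update_self]
      omega
    · rw [Fintype.prod_eq_mul_prod_compl i, Fintype.prod_eq_mul_prod_compl i]
      have : ∏ l ∈ {i}ᶜ, b.coord l x ^ Function.update n i (n i - 1) l =
          ∏ l ∈ {i}ᶜ, b.coord l x ^ n l :=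
        Finset.prod_congr rfl fun l hl => by
          rw [Function.update_of_ne]; simpa using hl
      rw [this, Function.update_self, ← mul_assoc, ← pow_succ', Nat.sub_add_cancel (by omega)]

theorem affine_apply_eq_sum (g : Pt d →ᵃ[ℝ] ℝ) (x : Pt d) :
    g x = ∑ i, g (b i) * b.coord i x := by
  have h := Finset.map_affineCombination Finset.univ b (fun i => b.coord i x)
    (b.sum_coord_apply_eq_one x) g
  rw [AffineBasis.affineCombination_coord_eq_self,
    Finset.affineCombination_eq_linear_combination _ _ _ (b.sum_coord_apply_eq_one x)] at h
  rw [h]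
  exact Finset.sum_congr rfl fun i _ => by simp [mul_comm]

/-- The affine function with the same values at the vertices. -/
def affineInterp : (Pt d → ℝ) →ₗ[ℝ] (Pt d → ℝ) :=
  ∑ i, (LinearMap.proj (b i)).smulRight (fun x => b.coord i x)

theorem affineInterp_apply (p : Pt d → ℝ) (x : Pt d) :
    affineInterp b p x = ∑ i, p (b i) * b.coord i x := by
  simp [affineInterp]

theorem affineInterp_of_mem {p : Pt d → ℝ} (hp : p ∈ polySimplex b 1) : affineInterp b p = p := by
  have h : polySimplex b 1 ≤ LinearMap.eqLocus (affineInterp b) LinearMap.id := by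
    refine Submodule.span_le.2 ?_
    rintro _ ⟨n, hn, rfl⟩
    obtain ⟨g, m, hm, hg⟩ := exists_affine_mul_monomial b n hn
    have hm0 : ∀ i, m i = 0 := by simpa using hm
    funext x
    simp [affineInterp_apply, hg, hm0, ← affine_apply_eq_sum]
  exact h hp

/-- The second difference of a function along the edge from `b i` to `b k`. It vanishes on affine
functions, and on `λ_i λ_k` it is `1`. -/
def edgeDiff (i k : Fin (d + 1)) : (Pt d → ℝ) →ₗ[ℝ] ℝ :=
  (4 : ℝ) • LinearMap.proj (midpoint ℝ (b i) (b k)) - (2 : ℝ) • LinearMap.proj (b i) -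
    (2 : ℝ) • LinearMap.proj (b k)

theorem edgeDiff_apply (i k : Fin (d + 1)) (p : Pt d → ℝ) :
    edgeDiff b i k p = 4 * p (midpoint ℝ (b i) (b k)) - 2 * p (b i) - 2 * p (b k) := rfl

theorem affine_midpoint (g : Pt d →ᵃ[ℝ] ℝ) (x y : Pt d) :
    g (midpoint ℝ x y) = (g x + g y) / 2 := by
  rw [g.map_midpoint, midpoint_eq_smul_add, smul_eq_mul, invOf_eq_inv]
  ring

theorem edgeDiff_affine_mul_affine (i k : Fin (d + 1)) (g h : Pt d →ᵃ[ℝ] ℝ) :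
    edgeDiff b i k (fun x => g x * h x) = -((g (b i) - g (b k)) * (h (b i) - h (b k))) := by
  rw [edgeDiff_apply, affine_midpoint, affine_midpoint]
  ring

theorem edgeDiff_of_mem_polySimplex_one (i k : Fin (d + 1)) {p : Pt d → ℝ}
    (hp : p ∈ polySimplex b 1) : edgeDiff b i k p = 0 := by
  have h : polySimplex b 1 ≤ LinearMap.ker (edgeDiff b i k) := by
    refine Submodule.span_le.2 ?_
    rintro _ ⟨n, hn, rfl⟩
    obtain ⟨g, m, hm, hg⟩ := exists_affine_mul_monomial b n hn
    have hm0 : ∀ i, m i = 0 := by simpa using hm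
    simp only [hg, hm0, pow_zero, Finset.prod_const_one]
    have := edgeDiff_affine_mul_affine b i k g (AffineMap.const ℝ _ 1)
    simpa using this
  exact h hp

/-- The quadratic Lagrange interpolant with nodes at the vertices and the midpoints of the edges,
written with the second differences along the edges. -/
def quadInterp : (Pt d → ℝ) →ₗ[ℝ] (Pt d → ℝ) :=
  affineInterp b + (1 / 2 : ℝ) • ∑ i, ∑ k, (edgeDiff b i k).smulRight
    (fun x => b.coord i x * b.coord k x)

theorem quadInterp_apply (p : Pt d → ℝ) (x : Pt d) :
    quadInterp b p x = ∑ i, p (b i) * b.coord i x +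
      1 / 2 * ∑ i, ∑ k, edgeDiff b i k p * (b.coord i x * b.coord k x) := by
  simp [quadInterp, affineInterp_apply]

theorem quadInterp_of_mem {p : Pt d → ℝ} (hp : p ∈ polySimplex b 2) : quadInterp b p = p := by
  have h : polySimplex b 2 ≤ LinearMap.eqLocus (quadInterp b) LinearMap.id := by
    refine Submodule.span_le.2 ?_
    rintro _ ⟨n, hn, rfl⟩
    obtain ⟨g, m, hm, hg⟩ := exists_affine_mul_monomial b n hn
    obtain ⟨h, l, hl, hh⟩ := exists_affine_mul_monomial b m hm
    have hl0 : ∀ i, l i = 0 := by simpa using hl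
    funext x
    simp only [hg, hh, hl0, pow_zero, Finset.prod_const_one, mul_one, LinearMap.id_coe, id_eq,
      quadInterp_apply, edgeDiff_affine_mul_affine]
    have h1 := b.sum_coord_apply_eq_one x
    have hgx := affine_apply_eq_sum b g x
    have hhx := affine_apply_eq_sum b h x
    have e1 : ∑ i, ∑ k, -((g (b i) - g (b k)) * (h (b i) - h (b k))) *
        (b.coord i x * b.coord k x) =
        (∑ i, g (b i) * b.coord i x) * (∑ k, h (b k) * b.coord k x) +
        (∑ i, h (b i) * b.coord i x) * (∑ k, g (b k) * b.coord k x) -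
        (∑ i, g (b i) * h (b i) * b.coord i x) * (∑ k, b.coord k x) -
        (∑ i, b.coord i x) * (∑ k, g (b k) * h (b k) * b.coord k x) := by
      simp only [Finset.sum_mul_sum, ← Finset.sum_add_distrib, ← Finset.sum_sub_distrib]
      exact Finset.sum_congr rfl fun i _ => Finset.sum_congr rfl fun k _ => by ring
    rw [e1, h1, ← hgx, ← hhx]
    ring
  exact h hp

theorem vertex_mem_simplex (i : Fin (d + 1)) : b i ∈ simplex b :=
  subset_convexHull ℝ _ (mem_range_self i)

theorem midpoint_mem_simplex (i k : Fin (d + 1)) : midpoint ℝ (b i) (b k) ∈ simplex b :=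
  (convex_convexHull ℝ _).midpoint_mem (vertex_mem_simplex b i) (vertex_mem_simplex b k)

/-- The nodes `i = k` are the vertices. -/
theorem eq_zero_of_mem_polySimplex {p : Pt d → ℝ} (hp : p ∈ polySimplex b 2)
    (h0 : ∀ i k, p (midpoint ℝ (b i) (b k)) = 0) : p = 0 := by
  have h1 : ∀ i, p (b i) = 0 := fun i => by simpa using h0 i i
  rw [← quadInterp_of_mem b hp]
  funext x
  simp [quadInterp_apply, edgeDiff_apply, h0, h1]

/-- Evaluation at the vertices and the midpoints of the edges, which are indexed by the unordered
pairs of indices of vertices. -/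
def nodeValues : polySimplex b 2 →ₗ[ℝ] (Sym2 (Fin (d + 1)) → ℝ) where
  toFun p s := s.lift ⟨fun i k => p.1 (midpoint ℝ (b i) (b k)), fun i k => by
    beta_reduce; rw [midpoint_comm]⟩
  map_add' p q := by
    funext s
    induction s with | _ i k => rfl
  map_smul' c p := by
    funext s
    induction s with | _ i k => rfl

theorem nodeValues_bijective : Function.Bijective (nodeValues b) := by
  constructor
  · rw [← LinearMap.ker_eq_bot, LinearMap.ker_eq_bot']
    intro p hp
    exact Subtype.ext (eq_zero_of_mem_polySimplex b p.2 fun i k => congrFun hp s(i, k))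
  · intro y
    let F : Fin (d + 1) → Fin (d + 1) → ℝ := fun i k =>
      4 * y s(i, k) - 2 * y s(i, i) - 2 * y s(k, k)
    let p : Pt d → ℝ := ∑ i, y s(i, i) • (fun x => b.coord i x) +
      (1 / 2 : ℝ) • ∑ i, ∑ k, F i k • (fun x => b.coord i x * b.coord k x)
    have hp : p ∈ polySimplex b 2 :=
      Submodule.add_mem _ (Submodule.sum_mem _ fun i _ => Submodule.smul_mem _ _
        (polySpan_mono b _ one_le_two (coord_mem_polySpan b (Finset.mem_univ i))))
        (Submodule.smul_mem _ _ (Submodule.sum_mem _ fun i _ => Submodule.sum_mem _ fun k _ =>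
          Submodule.smul_mem _ _ (coord_mul_coord_mem_polySimplex b i k)))
    refine ⟨⟨p, hp⟩, funext fun s => ?_⟩
    induction s with
    | _ a c =>
      change p (midpoint ℝ (b a) (b c)) = y s(a, c)
      have hm : ∀ i, b.coord i (midpoint ℝ (b a) (b c)) =
          ((if i = a then 1 else 0) + (if i = c then 1 else 0)) / 2 := fun i => by
        rw [affine_midpoint, b.coord_apply, b.coord_apply]
      have hswap : F c a = F a c := by
        simp only [F, Sym2.eq_swap (a := c) (b := a)]; ring
      have hdiag : ∀ i, F i i = 0 := fun i => by simp only [F]; ring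
      have hpm : p (midpoint ℝ (b a) (b c)) = (y s(a, a) + y s(c, c)) / 2 + F a c / 4 := by
        simp only [p, Pi.add_apply, Finset.sum_apply, Pi.smul_apply, smul_eq_mul, hm,
          mul_div_assoc', div_mul_eq_mul_div, mul_add, mul_ite, mul_one, mul_zero, one_mul, ← Finset.sum_div,
          Finset.sum_add_distrib, Finset.sum_ite_eq', Finset.mem_univ, if_true, hdiag, hswap]
        simp
        ring
      rw [hpm]
      simp only [F]
      ring

instance : FiniteDimensional ℝ (polySimplex b 2) :=
  Module.Finite.equiv (LinearEquiv.ofBijective _ (nodeValues_bijective b)).symm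

theorem finrank_polySimplex_two : Module.finrank ℝ (polySimplex b 2) = (d + 2).choose 2 := by
  rw [(LinearEquiv.ofBijective _ (nodeValues_bijective b)).finrank_eq, Module.finrank_pi,
    Sym2.card, Fintype.card_fin]

theorem linearIndependent_coord : LinearIndependent ℝ fun i x => b.coord i x := by
  rw [Fintype.linearIndependent_iff]
  intro c hc i
  have := congrFun hc (b i)
  simpa [Finset.sum_apply, b.coord_apply] using this

theorem span_coord_eq : Submodule.span ℝ (range fun i x => b.coord i x) = polySimplex b 1 := by
  refine le_antisymm (Submodule.span_le.2 ?_) fun p hp => ?_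
  · rintro _ ⟨i, rfl⟩
    exact coord_mem_polySpan b (Finset.mem_univ i)
  · rw [← affineInterp_of_mem b hp, affineInterp, LinearMap.sum_apply]
    exact Submodule.sum_mem _ fun i _ => Submodule.smul_mem _ _
      (Submodule.subset_span (mem_range_self i))

theorem polyFace_le_polySimplex (j : Fin (d + 1)) (k : ℕ) : polyFace b j k ≤ polySimplex b k := by
  refine Submodule.span_mono ?_
  rintro _ ⟨n, hn, rfl⟩
  have hne : ∀ i ∈ ({j}ᶜ : Finset (Fin (d + 1))), Function.update n j 0 i = n i := fun i hi => by
    rw [Function.update_of_ne]; simpa using hi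
  refine ⟨Function.update n j 0, ?_, ?_⟩
  · rwa [Fintype.sum_eq_add_sum_compl j, Finset.sum_congr rfl hne, Function.update_self, zero_add]
  · funext x
    rw [Fintype.prod_eq_mul_prod_compl j, Function.update_self, pow_zero, one_mul]
    exact Finset.prod_congr rfl fun i hi => by rw [hne i hi]

/-- The restriction to `F_j` of a polynomial is a polynomial on `F_j`: drop the monomials that
contain `λ_j`. -/
theorem exists_polyFace_eqOn (j : Fin (d + 1)) (k : ℕ) {p : Pt d → ℝ} (hp : p ∈ polySimplex b k) :
    ∃ p' ∈ polyFace b j k, ∀ x, b.coord j x = 0 → p' x = p x := by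
  induction hp using Submodule.span_induction with
  | mem p hp =>
    obtain ⟨n, hn, rfl⟩ := hp
    by_cases h : n j = 0
    · refine ⟨_, Submodule.subset_span ⟨n, ?_, rfl⟩, fun x _ => ?_⟩ <;> beta_reduce
      · rw [Fintype.sum_eq_add_sum_compl j] at hn
        omega
      · rw [Fintype.prod_eq_mul_prod_compl j, h, pow_zero, one_mul]
    · refine ⟨0, Submodule.zero_mem _, fun x hx => ?_⟩
      beta_reduce
      rw [Fintype.prod_eq_mul_prod_compl j, hx, zero_pow h, zero_mul]
      rfl
  | zero => exact ⟨0, Submodule.zero_mem _, fun _ _ => rfl⟩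
  | add p q _ _ hp hq =>
    obtain ⟨p', hp', h1⟩ := hp
    obtain ⟨q', hq', h2⟩ := hq
    exact ⟨p' + q', Submodule.add_mem _ hp' hq', fun x hx => by simp [h1 x hx, h2 x hx]⟩
  | smul c p _ hp =>
    obtain ⟨p', hp', h1⟩ := hp
    exact ⟨c • p', Submodule.smul_mem _ c hp', fun x hx => by simp [h1 x hx]⟩

end Poly

/-! ### Weighted pairings -/

section Pairing

variable {d : ℕ}

/-- The weight `w` makes the pairing `wInner ν w` of continuous functions an honest integral. -/
def PairsContinuous (ν : Measure (Pt d)) (w : Pt d → ℝ) : Prop :=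
  ∀ f g : Pt d → ℝ, Continuous f → Continuous g → Integrable (fun x => f x * g x * w x) ν

theorem wInner_comm (ν : Measure (Pt d)) (w f g : Pt d → ℝ) : wInner ν w f g = wInner ν w g f := by
  simp only [wInner, mul_comm (f _)]

theorem PairsContinuous.wInner_add_left {ν : Measure (Pt d)} {w f f' g : Pt d → ℝ}
    (h : PairsContinuous ν w) (hf : Continuous f) (hf' : Continuous f') (hg : Continuous g) :
    wInner ν w (f + f') g = wInner ν w f g + wInner ν w f' g := by
  simp only [wInner, Pi.add_apply, add_mul]
  exact integral_add (h f g hf hg) (h f' g hf' hg)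

theorem wInner_smul_left (ν : Measure (Pt d)) (w : Pt d → ℝ) (c : ℝ) (f g : Pt d → ℝ) :
    wInner ν w (c • f) g = c * wInner ν w f g := by
  simp only [wInner, Pi.smul_apply, smul_eq_mul, mul_assoc]
  exact integral_const_mul _ _

/-- The pairing `wInner ν w` as a bilinear form on the quadratic polynomials. -/
def pairingForm (b : Vertices d) {ν : Measure (Pt d)} {w : Pt d → ℝ} (h : PairsContinuous ν w) :
    LinearMap.BilinForm ℝ (polySimplex b 2) :=
  LinearMap.mk₂ ℝ (fun f g => wInner ν w f g)
    (fun f f' g => h.wInner_add_left (continuous_of_mem_polySpan b f.2)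
      (continuous_of_mem_polySpan b f'.2) (continuous_of_mem_polySpan b g.2))
    (fun c f g => wInner_smul_left ν w c f g)
    (fun f g g' => by
      simp only [wInner_comm ν w (f : Pt d → ℝ)]
      exact h.wInner_add_left (continuous_of_mem_polySpan b g.2)
        (continuous_of_mem_polySpan b g'.2) (continuous_of_mem_polySpan b f.2))
    (fun c f g => by
      simp only [wInner_comm ν w (f : Pt d → ℝ)]
      exact wInner_smul_left ν w c g f)

theorem pairsContinuous_dirichlet (b : Vertices d) {α : Fin (d + 1) → ℝ} (hα : ∀ i, 0 < α i) :
    PairsContinuous (simplexMeasure b) (dirichlet b α) := fun _ _ hf hg =>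
  IntegrableOn.continuousOn_mul (hf.mul hg).continuousOn (integrable_dirichlet b α hα)
    (isCompact_simplex b)

/-- Vanishing almost everywhere is vanishing for a continuous function, as the simplex is the
closure of its interior. -/
theorem eqOn_zero_of_wInner_self_eq_zero (b : Vertices d) {α : Fin (d + 1) → ℝ}
    (hα : ∀ i, 0 < α i) {f : Pt d → ℝ} (hf : Continuous f)
    (h : wInner (simplexMeasure b) (dirichlet b α) f f = 0) : ∀ x ∈ simplex b, f x = 0 := by
  have hpos := ae_dirichlet_pos b α hα
  rw [wInner, integral_eq_zero_iff_of_nonneg_ae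
    (hpos.mono fun x hx => mul_nonneg (mul_self_nonneg _) hx.le)
    (pairsContinuous_dirichlet b hα f f hf hf)] at h
  have h0 : f =ᵐ[volume.restrict (simplex b)] fun _ => 0 := by
    filter_upwards [h, hpos] with x hx hx'
    have : f x * f x = 0 := (mul_eq_zero.1 hx).resolve_right hx'.ne'
    exact mul_self_eq_zero.1 this
  exact Measure.eqOn_of_ae_eq h0 hf.continuousOn continuousOn_const
    (simplex_subset_closure_interior b)

theorem wInner_self_nonneg (b : Vertices d) {α : Fin (d + 1) → ℝ} (hα : ∀ i, 0 < α i)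
    (f : Pt d → ℝ) : 0 ≤ wInner (simplexMeasure b) (dirichlet b α) f f :=
  integral_nonneg_of_ae ((ae_dirichlet_pos b α hα).mono fun _ hx =>
    mul_nonneg (mul_self_nonneg _) hx.le)

theorem eq_zero_of_wInner_self_eq_zero (b : Vertices d) {α : Fin (d + 1) → ℝ}
    (hα : ∀ i, 0 < α i) {p : Pt d → ℝ} (hp : p ∈ polySimplex b 2)
    (h : wInner (simplexMeasure b) (dirichlet b α) p p = 0) : p = 0 :=
  eq_zero_of_mem_polySimplex b hp fun i k =>
    eqOn_zero_of_wInner_self_eq_zero b hα (continuous_of_mem_polySpan b hp) h _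
      (midpoint_mem_simplex b i k)

end Pairing

section FacePairing

variable {n : ℕ} (b : Vertices (n + 1)) (j : Fin (n + 2)) {α : Fin (n + 2) → ℝ}

theorem wInner_faceMeasure (f g : Pt (n + 1) → ℝ) :
    wInner (faceMeasure b j) (dirichletFace b α j) f g =
      wInner (simplexMeasure (faceVertices b j)) (dirichlet (faceVertices b j) (α ∘ j.succAbove))
        (f ∘ faceMap b j) (g ∘ faceMap b j) := by
  simp [wInner, integral_faceMeasure, dirichletFace_faceMap]

theorem pairsContinuous_dirichletFace (hα : ∀ i, 0 < α i) :
    PairsContinuous (faceMeasure b j) (dirichletFace b α j) := fun f g hf hg => by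
  have hc := (faceMap b j).isometry.continuous
  rw [faceMeasure_eq_map, (measurableEmbedding_faceMap b j).integrable_map_iff]
  convert pairsContinuous_dirichlet (faceVertices b j) (α := α ∘ j.succAbove) (fun i => hα _) _ _
    (hf.comp hc) (hg.comp hc) using 1
  funext z
  simp [dirichletFace_faceMap]

theorem wInner_faceMeasure_congr_right (w f : Pt (n + 1) → ℝ) {g g' : Pt (n + 1) → ℝ}
    (h : ∀ x, b.coord j x = 0 → g x = g' x) :
    wInner (faceMeasure b j) w f g = wInner (faceMeasure b j) w f g' := by
  have h' : ∀ z, g (faceMap b j z) = g' (faceMap b j z) := fun z => h _ (by simp)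
  simp only [wInner, integral_faceMeasure, h']

theorem midpoint_eq_faceMap (i k : Fin (n + 1)) :
    midpoint ℝ (b (j.succAbove i)) (b (j.succAbove k)) =
      faceMap b j (midpoint ℝ (faceVertices b j i) (faceVertices b j k)) := by
  have h := (faceMap b j).toAffineMap.map_midpoint (faceVertices b j i) (faceVertices b j k)
  simp only [AffineIsometry.coe_toAffineMap, faceMap_faceVertices] at h
  exact h.symm

/-- The radical of the face pairing is contained in the kernel of the second difference along an
edge of the face. -/
theorem edgeDiff_eq_zero_of_wInner_faceMeasure (hα : ∀ i, 0 < α i) {p : Pt (n + 1) → ℝ}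
    (hp : Continuous p) (h : wInner (faceMeasure b j) (dirichletFace b α j) p p = 0)
    (i k : Fin (n + 1)) : edgeDiff b (j.succAbove i) (j.succAbove k) p = 0 := by
  rw [wInner_faceMeasure] at h
  have h0 := eqOn_zero_of_wInner_self_eq_zero (faceVertices b j) (fun i => hα _)
    (hp.comp (faceMap b j).isometry.continuous) h
  have h1 : ∀ i, p (b (j.succAbove i)) = 0 := fun i => by
    rw [← faceMap_faceVertices]
    exact h0 _ (vertex_mem_simplex _ i)
  have h2 : p (midpoint ℝ (b (j.succAbove i)) (b (j.succAbove k))) = 0 := by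
    rw [midpoint_eq_faceMap]
    exact h0 _ (midpoint_mem_simplex _ i k)
  rw [edgeDiff_apply, h1, h1, h2]
  norm_num

end FacePairing

/-! ### Symmetric bilinear forms -/

/-- A symmetric bilinear form represents every linear functional that vanishes on its radical. -/
theorem exists_forall_bilinForm_eq {V : Type*} [AddCommGroup V] [Module ℝ V]
    [FiniteDimensional ℝ V] (B : LinearMap.BilinForm ℝ V) (hB : ∀ x y, B x y = B y x)
    (f : V →ₗ[ℝ] ℝ) (hf : ∀ v, B v = 0 → f v = 0) : ∃ q, ∀ p, B q p = f p := by
  have hmem : f ∈ LinearMap.range (LinearMap.dualMap B) := by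
    rw [LinearMap.range_dualMap_eq_dualAnnihilator_ker, Submodule.mem_dualAnnihilator]
    exact fun v hv => hf v hv
  obtain ⟨g, hg⟩ := hmem
  obtain ⟨q, rfl⟩ := (Module.evalEquiv ℝ V).surjective g
  exact ⟨q, fun p => by rw [← hg, hB]; rfl⟩

/-- The orthogonal complement for a positive definite form has an orthonormal basis. -/
theorem exists_orthonormal_span_eq_orthogonal {V : Type*} [AddCommGroup V] [Module ℝ V]
    [FiniteDimensional ℝ V] (B : LinearMap.BilinForm ℝ V) (hB : ∀ x y, B x y = B y x)
    (hpos : ∀ x, x ≠ 0 → 0 < B x x) (U : Submodule ℝ V) {N : ℕ}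
    (hN : Module.finrank ℝ (B.orthogonal U) = N) :
    ∃ ρ : Fin N → V, (∀ k l, B (ρ k) (ρ l) = if k = l then 1 else 0) ∧
      Submodule.span ℝ (range ρ) = B.orthogonal U := by
  let W := B.orthogonal U
  have hsymm : LinearMap.IsSymm (B.restrict W) := ⟨fun x y => hB x y⟩
  obtain ⟨v', hv'⟩ := LinearMap.BilinForm.exists_orthogonal_basis hsymm
  let v := v'.reindex (finCongr hN)
  have hv : ∀ k l, k ≠ l → B (v k) (v l) = 0 := fun k l hkl => by
    have : (finCongr hN).symm k ≠ (finCongr hN).symm l := (finCongr hN).symm.injective.ne hkl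
    simpa [v, LinearMap.IsOrthoᵢ] using hv' this
  have hvpos : ∀ k, 0 < B (v k) (v k) := fun k =>
    hpos _ fun h => v.ne_zero k (Subtype.ext h)
  refine ⟨fun k => (√(B (v k) (v k)))⁻¹ • (v k : V), fun k l => ?_, ?_⟩
  · simp only [map_smul, LinearMap.smul_apply, smul_eq_mul]
    split_ifs with h
    · subst h
      have := hvpos k
      rw [← mul_assoc, ← mul_inv, Real.mul_self_sqrt this.le, inv_mul_cancel₀ this.ne']
    · rw [hv k l h, mul_zero, mul_zero]
  · have hspan : Submodule.span ℝ (range fun k => (v k : V)) = W := by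
      have h := congrArg (Submodule.map W.subtype) v.span_eq
      rw [Submodule.map_span, ← range_comp, Submodule.map_top, Submodule.range_subtype] at h
      exact h
    refine le_antisymm (Submodule.span_le.2 ?_) ?_
    · rintro _ ⟨k, rfl⟩
      exact W.smul_mem _ (v k).2
    · refine hspan.ge.trans (Submodule.span_le.2 ?_)
      rintro _ ⟨k, rfl⟩
      have h0 : √(B (v k) (v k)) ≠ 0 := (Real.sqrt_pos.2 (hvpos k)).ne'
      have := Submodule.smul_mem (Submodule.span ℝ
        (range fun k => (√(B (v k) (v k)))⁻¹ • (v k : V))) (√(B (v k) (v k)))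
        (Submodule.subset_span (mem_range_self k))
      simpa [smul_smul, h0] using this

/-! ### Unisolvence and the Schur complement -/

/-- The number of functionals in `Σ` is the dimension of `ℙ_2(S_d)`, for `d = m + 2`. -/
theorem card_dofs (m : ℕ) :
    (m + 3) + ((m + 3) + numInterior (m + 2)) = (m + 4).choose 2 := by
  have h2 : 2 ∣ m * (m + 3) := by
    have := Nat.even_mul_succ_self m
    have h : m * (m + 3) = m * (m + 1) + 2 * m := by ring
    rw [h]
    exact (Nat.dvd_add this.two_dvd (dvd_mul_right 2 m))
  rw [numInterior, Nat.choose_two_right, Nat.add_sub_cancel]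
  obtain ⟨c, hc⟩ := h2
  have h4 : (m + 4) * (m + 4 - 1) = 2 * (m + 3 + (m + 3 + c)) := by
    have : m + 4 - 1 = m + 3 := rfl
    rw [this]
    linarith
  rw [h4, show m + 2 + 1 = m + 3 from rfl, hc]
  simp

section Unisolvence

variable {m : ℕ} (b : Vertices (m + 2)) {α : Fin (m + 3) → ℝ}
  {q ψ : Fin (m + 3) → Pt (m + 2) → ℝ} {ρ : Fin (numInterior (m + 2)) → Pt (m + 2) → ℝ}

/-- The matrix of the face averages of the barycentric coordinates has zero diagonal and the
off-diagonal entries `α_i / (∑ α - α_j)`. It is invertible because, up to the scaling of its rows,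
it is a diagonal matrix subtracted from a matrix of rank one. -/
theorem isUnit_faceAvg_coord (hα : ∀ i, 0 < α i) :
    IsUnit (Matrix.of fun j i => faceAvg b (dirichletFace b α) j fun x => b.coord i x) := by
  rw [← Matrix.mulVec_injective_iff_isUnit, ← Matrix.coe_mulVecLin, ← LinearMap.ker_eq_bot,
    LinearMap.ker_eq_bot']
  intro v hv
  have hA : ∀ j, 0 < ∑ k, α k - α j := fun j => by
    rw [Fin.sum_univ_succAbove α j, add_sub_cancel_left]
    exact Finset.sum_pos (fun i _ => hα _) Finset.univ_nonempty
  -- row `j` multiplied by `∑ α - α_j`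
  have hrow : ∀ j, α j * v j = ∑ i, α i * v i := fun j => by
    have h := congrFun hv j
    simp only [Matrix.mulVecLin_apply, Matrix.mulVec, dotProduct, Matrix.of_apply, faceAvg, wInner,
      Pi.one_apply, mul_one, integral_coord_mul_dirichletFace b j hα, Pi.zero_apply] at h
    have h' : ∑ i, (if i = j then 0 else α i * v i) = 0 := by
      have h0 := congrArg ((∑ k, α k - α j) * ·) h
      simp only [mul_zero, Finset.mul_sum] at h0
      refine (Finset.sum_congr rfl fun i _ => ?_).trans h0
      split_ifs
      · simp
      · field_simp [(hA j).ne']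
    have e : ∀ i, (if i = j then 0 else α i * v i) = α i * v i - if i = j then α i * v i else 0 :=
      fun i => by split_ifs <;> simp
    simp only [e, Finset.sum_sub_distrib, Finset.sum_ite_eq', Finset.mem_univ, if_true] at h'
    linarith
  -- summing the rows gives `S = (m + 3) S` for `S = ∑ α_i v_i`
  have hS : ∑ i, α i * v i = 0 := by
    have h := Finset.sum_congr rfl fun j (_ : j ∈ Finset.univ) => hrow j
    rw [Finset.sum_const, Finset.card_univ, Fintype.card_fin, nsmul_eq_mul] at h
    push_cast at h
    have : ((m : ℝ) + 2) * ∑ i, α i * v i = 0 := by linarith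
    exact (mul_eq_zero.1 this).resolve_left (by positivity)
  funext j
  exact (mul_eq_zero.1 ((hrow j).trans hS)).resolve_left (hα j).ne'

theorem quadFace_subset (j : Fin (m + 3)) (w : Pt (m + 2) → ℝ) :
    quadFace b j w ⊆ polySimplex b 2 := fun _ h => polyFace_le_polySimplex b j 2 h.1

/-- The elements of `𝕊_2(F_j)` annihilate the affine functions on the whole simplex, not only those
in the barycentric coordinates of the face. -/
theorem wInner_eq_zero_of_mem_quadFace {j : Fin (m + 3)} {w q p : Pt (m + 2) → ℝ}
    (hq : q ∈ quadFace b j w) (hp : p ∈ polySimplex b 1) :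
    wInner (faceMeasure b j) w p q = 0 := by
  obtain ⟨p', hp', h⟩ := exists_polyFace_eqOn b j 1 hp
  rw [wInner_comm, ← wInner_faceMeasure_congr_right b j w q h]
  exact hq.2 p' hp'

/-- The combined family of the barycentric coordinates, the `ψ_j` and the `ρ_k`, which is a basis of
`ℙ_2(S_d)` for an admissible choice. -/
def trialFamily (ψ : Fin (m + 3) → Pt (m + 2) → ℝ)
    (ρ : Fin (numInterior (m + 2)) → Pt (m + 2) → ℝ) :
    Fin (m + 3) ⊕ Fin (m + 3) ⊕ Fin (numInterior (m + 2)) → Pt (m + 2) → ℝ :=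
  Sum.elim (fun i x => b.coord i x) (Sum.elim ψ ρ)

theorem IsAdmissible.mem_interior {Om : Pt (m + 2) → ℝ} {om : Fin (m + 3) → Pt (m + 2) → ℝ}
    (h : IsAdmissible b Om om q ρ ψ) (k : Fin (numInterior (m + 2))) : ρ k ∈ quadSimplex b Om :=
  h.sup_eq.subset (SetLike.le_def.1 le_sup_left (Submodule.subset_span (mem_range_self k)))

theorem IsAdmissible.mem_face {Om : Pt (m + 2) → ℝ} {om : Fin (m + 3) → Pt (m + 2) → ℝ}
    (h : IsAdmissible b Om om q ρ ψ) (k : Fin (m + 3)) : ψ k ∈ quadSimplex b Om :=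
  h.sup_eq.subset (SetLike.le_def.1 le_sup_right (Submodule.subset_span (mem_range_self k)))

theorem IsAdmissible.trialFamily_mem {Om : Pt (m + 2) → ℝ} {om : Fin (m + 3) → Pt (m + 2) → ℝ}
    (h : IsAdmissible b Om om q ρ ψ) (l) : trialFamily b ψ ρ l ∈ polySimplex b 2 := by
  rcases l with i | i | k
  · exact polySpan_mono b _ one_le_two (coord_mem_polySpan b (Finset.mem_univ i))
  · exact (h.mem_face b i).1
  · exact (h.mem_interior b k).1

theorem IsAdmissible.linearIndependent_trialFamily (hα : ∀ i, 0 < α i)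
    (h : IsAdmissible b (dirichlet b α) (dirichletFace b α) q ρ ψ) :
    LinearIndependent ℝ (trialFamily b ψ ρ) := by
  refine (linearIndependent_coord b).sum_type
    (h.linInd_face.sum_type h.linInd_interior h.disjoint.symm) ?_
  rw [span_coord_eq, Sum.elim_range, Submodule.span_union, sup_comm, Submodule.disjoint_def]
  intro p hp1 hp2
  have hq := h.sup_eq.subset hp2
  exact eq_zero_of_wInner_self_eq_zero b hα hq.1 (hq.2 p hp1)

/-- The basis of `ℙ_2(S_d)` formed by the barycentric coordinates, the `ψ_j` and the `ρ_k`. -/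
def IsAdmissible.basis (hα : ∀ i, 0 < α i)
    (h : IsAdmissible b (dirichlet b α) (dirichletFace b α) q ρ ψ) :
    Module.Basis (Fin (m + 3) ⊕ Fin (m + 3) ⊕ Fin (numInterior (m + 2))) ℝ (polySimplex b 2) :=
  basisOfLinearIndependentOfCardEqFinrank
    (b := fun l => (⟨trialFamily b ψ ρ l, h.trialFamily_mem b l⟩ : polySimplex b 2))
    (LinearIndependent.of_comp (polySimplex b 2).subtype (h.linearIndependent_trialFamily b hα))
    (by
      rw [finrank_polySimplex_two, ← card_dofs]
      simp)

theorem IsAdmissible.coe_basis (hα : ∀ i, 0 < α i)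
    (h : IsAdmissible b (dirichlet b α) (dirichletFace b α) q ρ ψ) (l) :
    (h.basis b hα l : Pt (m + 2) → ℝ) = trialFamily b ψ ρ l := by
  simp [IsAdmissible.basis]

/-- The functionals of `Σ` as one linear map on `ℙ_2(S_d)`. -/
def IsAdmissible.dofsLinearMap (hα : ∀ i, 0 < α i)
    (h : IsAdmissible b (dirichlet b α) (dirichletFace b α) q ρ ψ) :
    polySimplex b 2 →ₗ[ℝ] (Fin (m + 3) ⊕ Fin (m + 3) ⊕ Fin (numInterior (m + 2)) → ℝ) where
  toFun p k := dofs b (dirichlet b α) (dirichletFace b α) q ρ k p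
  map_add' p p' := by
    have hc := continuous_of_mem_polySpan b p.2
    have hc' := continuous_of_mem_polySpan b p'.2
    funext k
    rcases k with j | j | k
    · exact (pairsContinuous_dirichletFace b j hα).wInner_add_left hc hc' continuous_one
    · exact (pairsContinuous_dirichletFace b j hα).wInner_add_left hc hc'
        (continuous_of_mem_polySpan b (quadFace_subset b j _ (h.test_mem j)))
    · exact (pairsContinuous_dirichlet b hα).wInner_add_left hc hc'
        (continuous_of_mem_polySpan b (h.mem_interior b k).1)
  map_smul' c p := by
    funext k
    rcases k with j | j | k <;> exact wInner_smul_left _ _ c p.1 _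

theorem isUnisolvent_iff_bijective (hα : ∀ i, 0 < α i)
    (h : IsAdmissible b (dirichlet b α) (dirichletFace b α) q ρ ψ) :
    IsUnisolvent (polySimplex b 2) (dofs b (dirichlet b α) (dirichletFace b α) q ρ) ↔
      Function.Bijective (h.dofsLinearMap b hα) := by
  rw [Function.bijective_iff_existsUnique]
  refine forall_congr' fun a => ⟨?_, ?_⟩
  · rintro ⟨p, ⟨hp, hpa⟩, huniq⟩
    exact ⟨⟨p, hp⟩, funext hpa, fun y hy => Subtype.ext (huniq y ⟨y.2, fun k => congrFun hy k⟩)⟩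
  · rintro ⟨p, hpa, huniq⟩
    exact ⟨p, ⟨p.2, fun k => congrFun hpa k⟩, fun y hy =>
      congrArg Subtype.val (huniq ⟨y, hy.1⟩ (funext hy.2))⟩

/-- In the basis formed by the barycentric coordinates, the `ψ_j` and the `ρ_k`, the functionals of
`Σ` have a block triangular matrix, since the quadratic moments annihilate affine functions. -/
theorem toMatrix_dofsLinearMap (hα : ∀ i, 0 < α i)
    (h : IsAdmissible b (dirichlet b α) (dirichletFace b α) q ρ ψ) :
    LinearMap.toMatrix (h.basis b hα) (Pi.basisFun ℝ _) (h.dofsLinearMap b hα) =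
      Matrix.fromBlocks
        (Matrix.of fun j i => faceAvg b (dirichletFace b α) j fun x => b.coord i x)
        (Matrix.of fun j l => faceAvg b (dirichletFace b α) j (Sum.elim ψ ρ l))
        0
        (Matrix.fromBlocks (matM b (dirichletFace b α) q ψ) (matCt b (dirichletFace b α) q ρ)
          (matC b (dirichlet b α) ρ ψ) (matG b (dirichlet b α) ρ)) := by
  have hentry : ∀ k l, LinearMap.toMatrix (h.basis b hα) (Pi.basisFun ℝ _)
      (h.dofsLinearMap b hα) k l =
      dofs b (dirichlet b α) (dirichletFace b α) q ρ k (trialFamily b ψ ρ l) := fun k l => by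
    rw [LinearMap.toMatrix_apply, ← h.coe_basis b hα l]
    rfl
  have hlam : ∀ i, (fun x => b.coord i x) ∈ polySimplex b 1 := fun i =>
    coord_mem_polySpan b (Finset.mem_univ i)
  ext k l
  rw [hentry]
  rcases k with j | j | k <;> rcases l with i | i | l <;> try rfl
  · exact wInner_eq_zero_of_mem_quadFace b (h.test_mem j) (hlam i)
  · exact (wInner_comm _ _ _ _).trans ((h.mem_interior b k).2 _ (hlam i))

/-- `G` is the Gram matrix of a linearly independent family. -/
theorem isUnit_matG (hα : ∀ i, 0 < α i)
    (h : IsAdmissible b (dirichlet b α) (dirichletFace b α) q ρ ψ) :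
    IsUnit (matG b (dirichlet b α) ρ) := by
  let B := pairingForm b (pairsContinuous_dirichlet b hα)
  let r : Fin (numInterior (m + 2)) → polySimplex b 2 := fun k => ⟨ρ k, (h.mem_interior b k).1⟩
  have hr : LinearIndependent ℝ r :=
    LinearIndependent.of_comp (polySimplex b 2).subtype h.linInd_interior
  rw [← Matrix.mulVec_injective_iff_isUnit, ← Matrix.coe_mulVecLin, ← LinearMap.ker_eq_bot,
    LinearMap.ker_eq_bot']
  intro v hv
  have hrow : ∀ k, B (∑ l, v l • r l) (r k) = 0 := fun k => by
    have := congrFun hv k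
    simp only [Matrix.mulVecLin_apply, Matrix.mulVec, dotProduct, matG, Matrix.of_apply,
      interiorMoment, Pi.zero_apply] at this
    simp only [map_sum, map_smul, LinearMap.sum_apply, LinearMap.smul_apply, smul_eq_mul]
    rw [← this]
    exact Finset.sum_congr rfl fun l _ => mul_comm _ _
  have hself : B (∑ l, v l • r l) (∑ l, v l • r l) = 0 := by
    rw [map_sum]
    exact Finset.sum_eq_zero fun l _ => by rw [map_smul, hrow, smul_zero]
  have h0 : ∑ l, v l • r l = 0 :=
    Subtype.ext (eq_zero_of_wInner_self_eq_zero b hα (Subtype.prop _) hself)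
  funext k
  exact Fintype.linearIndependent_iff.1 hr v h0 k

/-- Only the lower diagonal block can fail to be invertible, and its Schur complement over `G` is
`T`. -/
theorem isUnisolvent_iff_isUnit_matT (hα : ∀ i, 0 < α i)
    (h : IsAdmissible b (dirichlet b α) (dirichletFace b α) q ρ ψ) :
    IsUnisolvent (polySimplex b 2) (dofs b (dirichlet b α) (dirichletFace b α) q ρ) ↔
      IsUnit (matT b (dirichlet b α) (dirichletFace b α) q ρ ψ) := by
  have hG := isUnit_matG b hα h
  have := hG.invertible
  have hbij : Function.Bijective (h.dofsLinearMap b hα) ↔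
      IsUnit (LinearMap.toMatrix (h.basis b hα) (Pi.basisFun ℝ _) (h.dofsLinearMap b hα)) := by
    rw [Matrix.isUnit_iff_isUnit_det]
    exact ⟨fun hb => (LinearEquiv.ofBijective _ hb).isUnit_det _ _,
      fun hu => (LinearEquiv.ofIsUnitDet hu).bijective⟩
  rw [isUnisolvent_iff_bijective b hα h, hbij, toMatrix_dofsLinearMap,
    Matrix.isUnit_fromBlocks_zero₂₁, Matrix.isUnit_fromBlocks_iff_of_invertible₂₂,
    Matrix.invOf_eq_nonsing_inv]
  exact and_iff_right (isUnit_faceAvg_coord b hα)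

end Unisolvence

/-! ### Existence of unisolvent admissible choices -/

section Existence

variable {m : ℕ} (b : Vertices (m + 2)) {α : Fin (m + 3) → ℝ}

/-- On `F_j` the second difference along an edge of `F_j` is the pairing with an element of
`𝕊_2(F_j)`. -/
theorem exists_mem_quadFace_forall_wInner_eq_edgeDiff (hα : ∀ i, 0 < α i) (j i k : Fin (m + 3))
    (hi : i ≠ j) (hk : k ≠ j) :
    ∃ q ∈ quadFace b j (dirichletFace b α j), ∀ p ∈ polySimplex b 2,
      wInner (faceMeasure b j) (dirichletFace b α j) p q = edgeDiff b i k p := by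
  obtain ⟨i, rfl⟩ := Fin.exists_succAbove_eq hi
  obtain ⟨k, rfl⟩ := Fin.exists_succAbove_eq hk
  have hpair := pairsContinuous_dirichletFace b j hα
  obtain ⟨r, hr⟩ := exists_forall_bilinForm_eq (pairingForm b hpair)
    (fun x y => wInner_comm _ _ _ _)
    ((edgeDiff b (j.succAbove i) (j.succAbove k)).comp (polySimplex b 2).subtype)
    fun v hv => edgeDiff_eq_zero_of_wInner_faceMeasure b j hα (continuous_of_mem_polySpan b v.2)
      (LinearMap.congr_fun hv v) i k
  obtain ⟨q, hq, hqr⟩ := exists_polyFace_eqOn b j 2 r.2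
  have hrep : ∀ p ∈ polySimplex b 2, wInner (faceMeasure b j) (dirichletFace b α j) p q =
      edgeDiff b (j.succAbove i) (j.succAbove k) p := fun p hp => by
    rw [wInner_faceMeasure_congr_right b j _ p hqr, wInner_comm]
    exact hr ⟨p, hp⟩
  refine ⟨q, ⟨hq, fun φ hφ => ?_⟩, hrep⟩
  have hφ1 := polyFace_le_polySimplex b j 1 hφ
  rw [wInner_comm, hrep φ (polySpan_mono b _ one_le_two hφ1),
    edgeDiff_of_mem_polySimplex_one b _ _ hφ1]

theorem fin_add_one_add_one_ne (j : Fin (m + 3)) : j + 1 + 1 ≠ j := by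
  rw [add_assoc, Ne, add_eq_left]
  simp [Fin.ext_iff, Fin.val_add, Nat.mod_eq_of_lt (show 2 < m + 3 by omega)]

/-- The second differences along the edges of the cycle `b 0, b 1, …` are dual to the products
`λ_i λ_{i+1}`; there are at least three vertices, so that these edges are distinct. -/
theorem edgeDiff_coord_mul_coord_succ (i k : Fin (m + 3)) :
    edgeDiff b k (k + 1) (fun x => b.coord i x * b.coord (i + 1) x) = if i = k then 1 else 0 := by
  rw [edgeDiff_affine_mul_affine]
  simp only [b.coord_apply]
  have h1 : k ≠ k + 1 := by simp
  have h2 : k + 1 + 1 ≠ k := fin_add_one_add_one_ne k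
  by_cases h : i = k
  · subst h; simp [h1]
  · have h3 : i + 1 ≠ k + 1 := fun h' => h (add_right_cancel h')
    by_cases h4 : i = k + 1
    · subst h4; simp [h2, h3]
    · simp [h, h3, h4]

/-- With `ψ_j` the projection of `λ_j λ_{j+1}` onto `𝕊_2(S_d)`, with `ρ` an orthonormal basis of the
orthogonal complement of the `ψ_j`, and with `q_j` representing on `F_j` the second difference along
the edge from `b (j + 1)` to `b (j + 2)`, the matrix `T = M` is a permutation matrix. -/
theorem exists_admissible_isUnisolvent (hα : ∀ i, 0 < α i) :
    ∃ (q : Fin (m + 3) → Pt (m + 2) → ℝ) (ρ : Fin (numInterior (m + 2)) → Pt (m + 2) → ℝ)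
      (ψ : Fin (m + 3) → Pt (m + 2) → ℝ),
      IsAdmissible b (dirichlet b α) (dirichletFace b α) q ρ ψ ∧
      (∀ j, (fun x => b.coord j x * b.coord (j + 1) x) - ψ j ∈ polySimplex b 1) ∧
      matG b (dirichlet b α) ρ = 1 ∧ matC b (dirichlet b α) ρ ψ = 0 ∧
      IsUnisolvent (polySimplex b 2) (dofs b (dirichlet b α) (dirichletFace b α) q ρ) := by
  choose q hq hqrep using fun j => exists_mem_quadFace_forall_wInner_eq_edgeDiff b hα j (j + 1)
    (j + 1 + 1) (by simp) (fin_add_one_add_one_ne j)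
  let V := polySimplex b 2
  let B : LinearMap.BilinForm ℝ V := pairingForm b (pairsContinuous_dirichlet b hα)
  have hB : ∀ x y, B x y = B y x := fun x y => wInner_comm _ _ _ _
  have hBrefl : B.IsRefl := fun x y h => by rw [hB, h]
  have hB0 : ∀ x, B x x = 0 → x = 0 := fun x hx =>
    Subtype.ext (eq_zero_of_wInner_self_eq_zero b hα x.2 hx)
  have hpos : ∀ x, x ≠ 0 → 0 < B x x := fun x hx =>
    lt_of_le_of_ne (wInner_self_nonneg b hα _) fun h => hx (hB0 x h.symm)
  have hcompl : ∀ U : Submodule ℝ V, IsCompl U (B.orthogonal U) := fun U => by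
    rw [LinearMap.BilinForm.isCompl_orthogonal_iff_disjoint hBrefl, Submodule.disjoint_def]
    exact fun x hx hx' => hB0 x (hx' x hx)
  -- the affine functions inside `ℙ_2(S_d)`
  let lam : Fin (m + 3) → V := fun i =>
    ⟨fun x => b.coord i x, polySpan_mono b _ one_le_two (coord_mem_polySpan b (Finset.mem_univ i))⟩
  let P := Submodule.span ℝ (range lam)
  have hPmap : P.map V.subtype = polySimplex b 1 := by
    rw [Submodule.map_span, ← range_comp, ← span_coord_eq]
    rfl
  have hPmem : ∀ x : V, x ∈ P ↔ (x : Pt (m + 2) → ℝ) ∈ polySimplex b 1 := fun x => by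
    rw [← hPmap]
    exact ⟨fun h => Submodule.mem_map_of_mem h, fun ⟨y, hy, hxy⟩ => Subtype.ext hxy ▸ hy⟩
  -- the projections of the products `λ_j λ_{j+1}` along the affine functions
  let e : Fin (m + 3) → V := fun j => ⟨_, coord_mul_coord_mem_polySimplex b j (j + 1)⟩
  have hproj : ∀ j, ∃ ψ ∈ B.orthogonal P, e j - ψ ∈ P := fun j => by
    have h : e j ∈ P ⊔ B.orthogonal P := by rw [(hcompl P).sup_eq_top]; trivial
    obtain ⟨p, hp, ψ, hψ, hpψ⟩ := Submodule.mem_sup.1 h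
    exact ⟨ψ, hψ, by rwa [← hpψ, add_sub_cancel_right]⟩
  choose ψ hψ heψ using hproj
  have hedge : ∀ i k, edgeDiff b k (k + 1) (ψ i : Pt (m + 2) → ℝ) = if i = k then 1 else 0 := by
    intro i k
    have h := edgeDiff_of_mem_polySimplex_one b k (k + 1) ((hPmem _).1 (heψ i))
    rw [← edgeDiff_coord_mul_coord_succ b i k]
    rw [Submodule.coe_sub, map_sub, sub_eq_zero] at h
    exact h.symm
  have hψind : LinearIndependent ℝ ψ := by
    rw [Fintype.linearIndependent_iff]
    intro c hc k
    have h := congrArg (fun p : V => edgeDiff b k (k + 1) (p : Pt (m + 2) → ℝ)) hc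
    simpa [map_sum, hedge] using h
  have hlamind : LinearIndependent ℝ lam :=
    LinearIndependent.of_comp V.subtype (linearIndependent_coord b)
  let U := P ⊔ Submodule.span ℝ (range ψ)
  have hψle : Submodule.span ℝ (range ψ) ≤ B.orthogonal P :=
    Submodule.span_le.2 (by rintro _ ⟨j, rfl⟩; exact hψ j)
  have hU : Module.finrank ℝ U = (m + 3) + (m + 3) := by
    have hdisj : Disjoint P (Submodule.span ℝ (range ψ)) := (hcompl P).disjoint.mono_right hψle
    have h := finrank_span_eq_card (hlamind.sum_type hψind hdisj)
    rw [Sum.elim_range, Submodule.span_union] at h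
    rw [h]
    simp
  have hfin : Module.finrank ℝ (B.orthogonal U) = numInterior (m + 2) := by
    have h := Submodule.finrank_add_eq_of_isCompl (hcompl U)
    rw [hU, finrank_polySimplex_two, ← card_dofs] at h
    omega
  obtain ⟨ρ, hρ, hρspan⟩ := exists_orthonormal_span_eq_orthogonal B hB hpos U hfin
  have hρmem : ∀ k, ρ k ∈ B.orthogonal U := fun k =>
    hρspan ▸ Submodule.subset_span (mem_range_self k)
  have hρind : LinearIndependent ℝ ρ := by
    rw [Fintype.linearIndependent_iff]
    intro c hc k
    have h := congrArg (fun p => B p (ρ k)) hc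
    simpa [map_sum, LinearMap.sum_apply, hρ] using h
  -- `𝕊_2(S_d)` as the image of the orthogonal complement of the affine functions
  have hquad : ∀ p : V, (p : Pt (m + 2) → ℝ) ∈ quadSimplex b (dirichlet b α) ↔
      p ∈ B.orthogonal P := fun p => by
    constructor
    · intro hp x hx
      rw [hB]
      exact hp.2 x ((hPmem x).1 hx)
    · intro hp
      refine ⟨p.2, fun φ hφ => ?_⟩
      have := hp ⟨φ, polySpan_mono b _ one_le_two hφ⟩ ((hPmem _).2 hφ)
      rw [hB] at this
      exact this
  have hsup : Submodule.span ℝ (range ρ) ⊔ Submodule.span ℝ (range ψ) = B.orthogonal P := by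
    rw [hρspan]
    have hle : B.orthogonal U ≤ B.orthogonal P :=
      LinearMap.BilinForm.orthogonal_le le_sup_left
    refine le_antisymm (sup_le hle hψle) fun x hx => ?_
    have h : x ∈ U ⊔ B.orthogonal U := by rw [(hcompl U).sup_eq_top]; trivial
    obtain ⟨u, hu, y, hy, rfl⟩ := Submodule.mem_sup.1 h
    obtain ⟨p, hp, w, hw, rfl⟩ := Submodule.mem_sup.1 hu
    have hp' : p ∈ B.orthogonal P := by
      have := Submodule.sub_mem _ (Submodule.sub_mem _ hx (hle hy)) (hψle hw)
      rwa [add_sub_cancel_right, add_sub_cancel_right] at this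
    rw [hB0 p (hp' p hp), zero_add, add_comm w y]
    exact Submodule.add_mem_sup hy hw
  have hspanmap : ∀ {ι : Type} (f : ι → V), Submodule.span ℝ (range fun i => (f i : Pt (m + 2) → ℝ))
      = (Submodule.span ℝ (range f)).map V.subtype := fun f => by
    rw [Submodule.map_span, ← range_comp]; rfl
  have hadm : IsAdmissible b (dirichlet b α) (dirichletFace b α) q
      (fun k => (ρ k : Pt (m + 2) → ℝ)) (fun j => (ψ j : Pt (m + 2) → ℝ)) := by
    refine ⟨hq, hρind.map' V.subtype V.ker_subtype, hψind.map' V.subtype V.ker_subtype, ?_, ?_⟩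
    · rw [hspanmap, hspanmap]
      refine (Submodule.disjoint_map V.injective_subtype ?_)
      rw [hρspan]
      exact ((hcompl U).disjoint.mono_left le_sup_right).symm
    · rw [hspanmap, hspanmap, ← Submodule.map_sup, hsup]
      ext p
      constructor
      · rintro ⟨x, hx, rfl⟩
        exact (hquad x).2 hx
      · intro hp
        exact ⟨⟨p, hp.1⟩, (hquad ⟨p, hp.1⟩).1 hp, rfl⟩
  have hC : matC b (dirichlet b α) (fun k => (ρ k : Pt (m + 2) → ℝ))
      (fun j => (ψ j : Pt (m + 2) → ℝ)) = 0 := by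
    ext k j
    exact hρmem k (ψ j) (SetLike.le_def.1 le_sup_right (Submodule.subset_span (mem_range_self j)))
  refine ⟨q, fun k => ρ k, fun j => ψ j, hadm, fun j => (hPmem _).1 (heψ j), ?_, hC, ?_⟩
  · ext k l
    rw [Matrix.one_apply]
    exact (hB _ _).trans (hρ k l)
  · rw [isUnisolvent_iff_isUnit_matT b hα hadm, matT, hC, Matrix.mul_zero, sub_zero]
    -- `M` is the permutation matrix of the cyclic shift
    have hM : matM b (dirichletFace b α) q (fun j => (ψ j : Pt (m + 2) → ℝ)) =
        (Equiv.addRight (1 : Fin (m + 3))).permMatrix ℝ := by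
      ext j i
      refine (hqrep j _ (ψ i).2).trans ?_
      rw [hedge, Equiv.Perm.permMatrix, PEquiv.toMatrix_apply]
      simp [eq_comm]
    rw [hM, Matrix.isUnit_iff_isUnit_det, Matrix.det_permutation]
    exact (Equiv.Perm.sign _).isUnit.map (Int.castRingHom ℝ)

end Existence

end Histopolation

end

theorem corollary2 (d : ℕ) (hd : 2 ≤ d) (b : Histopolation.Vertices d)
    (α : Fin (d + 1) → ℝ) (hα : ∀ i, 0 < α i) :
    -- the Dirichlet weight is a probability density and induces the Dirichlet weights on the faces
    Histopolation.IsPosProbDensity (Histopolation.simplexMeasure b)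
      (Histopolation.dirichlet b α) ∧
    (∀ j, Histopolation.IsInducedFaceDensity b (Histopolation.dirichlet b α) j
      (Histopolation.dirichletFace b α j)) ∧
    -- unisolvence for suitable (explicit interior and face spaces) admissible polynomials
    (∃ (q : Fin (d + 1) → Histopolation.Pt d → ℝ)
        (ρ : Fin (Histopolation.numInterior d) → Histopolation.Pt d → ℝ)
        (ψ : Fin (d + 1) → Histopolation.Pt d → ℝ),
      Histopolation.IsAdmissible b (Histopolation.dirichlet b α)
        (Histopolation.dirichletFace b α) q ρ ψ ∧
      (∀ j, (fun x => b.coord j x * b.coord (j + 1) x) - ψ j ∈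
        Histopolation.polySimplex b 1) ∧
      Histopolation.matG b (Histopolation.dirichlet b α) ρ = 1 ∧
      Histopolation.matC b (Histopolation.dirichlet b α) ρ ψ = 0 ∧
      Histopolation.IsUnisolvent (Histopolation.polySimplex b 2)
        (Histopolation.dofs b (Histopolation.dirichlet b α)
          (Histopolation.dirichletFace b α) q ρ)) ∧
    -- for every choice of admissible polynomials, the Schur complement alone decides
    (∀ (q : Fin (d + 1) → Histopolation.Pt d → ℝ)
        (ρ : Fin (Histopolation.numInterior d) → Histopolation.Pt d → ℝ)
        (ψ : Fin (d + 1) → Histopolation.Pt d → ℝ),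
      Histopolation.IsAdmissible b (Histopolation.dirichlet b α)
        (Histopolation.dirichletFace b α) q ρ ψ →
      (Histopolation.IsUnisolvent (Histopolation.polySimplex b 2)
        (Histopolation.dofs b (Histopolation.dirichlet b α)
          (Histopolation.dirichletFace b α) q ρ) ↔
        IsUnit (Histopolation.matT b (Histopolation.dirichlet b α)
          (Histopolation.dirichletFace b α) q ρ ψ))) := by
  obtain ⟨m, rfl⟩ := Nat.exists_eq_add_of_le' hd
  exact ⟨Histopolation.isPosProbDensity_dirichlet b α hα,
    fun j => Histopolation.isInducedFaceDensity_dirichletFace b j hα,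
    Histopolation.exists_admissible_isUnisolvent b hα,
    fun _ _ _ h => Histopolation.isUnisolvent_iff_isUnit_matT b hα h⟩
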